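/- **Setting.** Let $\mathbb U=\{z\in\mathbb C:|z|=1\}$. For a probability measure $\mu$ on $\mathbb U$ put $m_k(\mu)=\int\zeta^k\,d\mu(\zeta)$ and $M_\mu(z)=\sum_{k\ge0}m_k(\mu)z^k$. If $m_1(\mu)\neq0$, the $S$-transform $S_\mu$ is the power series such that $zS_\mu(z)/(1+z)$ is the inverse under composition of $M_\mu(z)-1$. The measure $\mu$ is $\boxtimes$-infinitely divisible, $\mu\in\mathcal{ID}(\mathbb U,\boxtimes)$, if for every $n\ge1$ it is the $n$-th power, for free multiplicative convolution $\boxtimes$ (the law of the product of two $*$-free unitaries), of a probability measure on $\mathbb U$. Its $\boxtimes$-characteristic pair is $(\omega,\nu)$, with $\omega\in\mathbb U$ and $\nu$ a finite measure on $\mathbb U$, if $m_1(\mu)\ne 0$ and, for $z$ near $0$, $$S_\mu\!\left(\tfrac{z}{1-z}\right)=\omega^{-1}\exp\left(\int_{\mathbb U}\frac{1+\zeta z}{1-\zeta z}\,d\nu(\zeta)\right);$$ its $\boxtimes$-characteristic triplet is then $(\omega,b,\upsilon)$ with $b=2\nu(\{1\})$ and $\upsilon(d\zeta)=\frac{1}{1-\operatorname{Re}\zeta}1_{\zeta\neq1}\,\nu(d\zeta)$.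 For $\sigma,\tau\in\mathfrak S_n$ let $|\sigma|=n-\ell(\sigma)$, where $\ell(\sigma)$ is the number of cycles of $\sigma$ (fixed points included), $d(\sigma,\tau)=|\sigma^{-1}\tau|$, and write $\sigma\preceq\tau$ if $d(1,\sigma)+d(\sigma,\tau)=d(1,\tau)$; put $[1,\sigma]=\{\pi:\pi\preceq\sigma\}$. A chain in $[1,\sigma]$ is a tuple $\Gamma=(\sigma_0,\dots,\sigma_l)$ of elements of $[1,\sigma]$ with $\sigma_0\prec\cdots\prec\sigma_l$, of length $|\Gamma|=l\ge0$; it is simple if every $\sigma_{i-1}^{-1}\sigma_i$ is a nontrivial cycle. $\sharp c$ denotes the length of a cycle $c$, and products over cycles include the fixed points. The free cumulants $\kappa_k(\mu)$ are the coefficients of $M_\mu(W_\mu(z))=1+\sum_{k\ge1}\kappa_k(\mu)z^k$, where $W_\mu$ is the inverse under composition of $zM_\mu(z)$. If $m_1(\mu)\neq0$, the free log-cumulants of $\mu$ are $L\kappa_1(\mu)=\operatorname{Log}m_1(\mu)$ (principal logarithm) and, for $n\ge2$, $$L\kappa_n(\mu)=\sum_{\Gamma}\frac{(-1)^{1+|\Gamma|}}{|\Gamma|}\prod_{i=1}^{|\Gamma|}\Big(m_1(\mu)^{-n}\prod_{c\text{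 cycle of }\sigma_{i-1}^{-1}\sigma_i}\kappa_{\sharp c}(\mu)\Big),$$ the sum being over all chains $\Gamma=(\sigma_0,\dots,\sigma_{|\Gamma|})$ in $[1,(1\,2\cdots n)]\cong NC(n)$ with $\sigma_0=1$ and $\sigma_{|\Gamma|}=(1\,2\cdots n)$. **Proposition.** Let $\mu\in\mathcal{ID}(\mathbb U,\boxtimes)$ have $\boxtimes$-characteristic triplet $(\omega,b,\upsilon)$. For all $n\ge1$ and all $\sigma\in\mathfrak S_n$, $$\prod_{c\text{ cycle of }\sigma}m_{\sharp c}(\mu)=e^{nL\kappa_1(\mu)}\sum_{\Gamma}\frac1{|\Gamma|!}\prod_{i=1}^{|\Gamma|}L\kappa_{d(\sigma_i,\sigma_{i-1})+1}(\mu),$$ the sum being over all simple chains $\Gamma=(\sigma_0,\dots,\sigma_{|\Gamma|})$ in $[1,\sigma]$ with $\sigma_{|\Gamma|}=\sigma$. Moreover, all integrands below being $\upsilon$-integrable, 1. $L\kappa_1(\mu)=\operatorname{Log}\omega-\frac b2+\int_{\mathbb U}(\operatorname{Re}\zeta-1)\,d\upsilon(\zeta)$, 2. $L\kappa_2(\mu)=-b+\int_{\mathbb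 U}(\zeta-1)^2\,d\upsilon(\zeta)$, 3. $L\kappa_n(\mu)=\int_{\mathbb U}(\zeta-1)^n\,d\upsilon(\zeta)$ for all $n\ge3$. -/

import Mathlib

open MeasureTheory Filter Topology

noncomputable section

namespace FreeMul

instance : MeasurableSpace Circle := borel Circle

instance : BorelSpace Circle := ⟨rfl⟩

/-! ### Free multiplicative convolution on the unit circle -/

/-- A state on a unital complex `*`-algebra: a unital positive linear functional. -/
structure IsState {A : Type} [Ring A] [StarRing A] [Algebra ℂ A] (φ : A →ₗ[ℂ] ℂ) : Prop where
  map_one : φ 1 = 1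
  nonneg_re : ∀ a : A, 0 ≤ (φ (star a * a)).re
  im_eq_zero : ∀ a : A, (φ (star a * a)).im = 0

/-- Freeness of two `*`-subalgebras with respect to `φ`: every product of centered elements, taken
alternately from the two subalgebras, is centered. -/
def IsFreePair {A : Type} [Ring A] [StarRing A] [Algebra ℂ A] [StarModule ℂ A]
    (φ : A →ₗ[ℂ] ℂ) (B : Bool → StarSubalgebra ℂ A) : Prop :=
  ∀ l : List (Bool × A), l ≠ [] →
    l.IsChain (fun p q => p.1 ≠ q.1) →
    (∀ p ∈ l, p.2 ∈ B p.1 ∧ φ p.2 = 0) →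
    φ (l.map Prod.snd).prod = 0

/-- The `k`-th moment `m_k(μ) = ∫ ζ^k dμ(ζ)`. -/
def moment (μ : Measure Circle) (k : ℕ) : ℂ := ∫ ζ : Circle, (ζ : ℂ) ^ k ∂μ

/-- The unitary element `u` has distribution `μ` with respect to the state `φ`. -/
def HasLaw {A : Type} [Ring A] [StarRing A] [Algebra ℂ A]
    (φ : A →ₗ[ℂ] ℂ) (u : A) (μ : Measure Circle) : Prop :=
  u ∈ unitary A ∧ ∀ k : ℕ, φ (u ^ k) = moment μ k

/-- `ρ = μ ⊠ ν`: the measure `ρ` is the distribution of `u * v`, where `u` and `v` are `*`-free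
unitaries with distributions `μ` and `ν`. -/
def IsFreeMulConv (μ ν ρ : Measure Circle) : Prop :=
  ∃ (A : Type) (_ : Ring A) (_ : StarRing A) (_ : Algebra ℂ A) (_ : StarModule ℂ A)
    (φ : A →ₗ[ℂ] ℂ) (u v : A),
    IsState φ ∧ HasLaw φ u μ ∧ HasLaw φ v ν ∧
    IsFreePair φ (fun i => bif i then StarAlgebra.adjoin ℂ {u} else StarAlgebra.adjoin ℂ {v}) ∧
    HasLaw φ (u * v) ρ

/-- `ρ = ν ⊠ ⋯ ⊠ ν` (`n` factors), with `ν^{⊠0} = δ_1`. -/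
def IsFreeMulPow (ν : Measure Circle) : ℕ → Measure Circle → Prop
  | 0, ρ => ρ = Measure.dirac 1
  | n + 1, ρ => ∃ ρ' : Measure Circle, IsProbabilityMeasure ρ' ∧
      IsFreeMulPow ν n ρ' ∧ IsFreeMulConv ρ' ν ρ

/-- `μ ∈ ID(𝕌, ⊠)`. -/
def IsFreeMulInfDiv (μ : Measure Circle) : Prop :=
  IsProbabilityMeasure μ ∧ ∀ n : ℕ, 1 ≤ n →
    ∃ ν : Measure Circle, IsProbabilityMeasure ν ∧ IsFreeMulPow ν n μ

/-! ### The `S`-transform and the characteristic triplet -/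

/-- `M_μ(z) = ∑ m_k(μ) z^k`. -/
def momentSeries (μ : Measure Circle) : PowerSeries ℂ := PowerSeries.mk (moment μ)

/-- `S` is the `S`-transform of `μ`: the series `z S(z) / (1 + z)` is the inverse under composition
of `M_μ(z) - 1`. (For a probability measure such an `S` exists if and only if `m_1(μ) ≠ 0`, and it
is then unique.) -/
def IsSTransform (μ : Measure Circle) (S : PowerSeries ℂ) : Prop :=
  (momentSeries μ - 1).subst (PowerSeries.X * S * (1 + PowerSeries.X)⁻¹) = PowerSeries.X ∧
  (PowerSeries.X * S * (1 + PowerSeries.X)⁻¹).subst (momentSeries μ - 1) = PowerSeries.X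

/-- `(ω, ν)` is the `⊠`-characteristic pair of `μ`: near `0`, with `S` the `S`-transform of `μ`,
`Σ_μ(z) = S(z / (1 - z)) = ω⁻¹ exp (∫ (1 + ζ z) / (1 - ζ z) dν(ζ))`. -/
def IsCharPair (μ : Measure Circle) (ω : Circle) (ν : Measure Circle) : Prop :=
  IsFiniteMeasure ν ∧ ∃ S : PowerSeries ℂ, IsSTransform μ S ∧
    ∀ᶠ z : ℂ in 𝓝 0, HasSum (fun k : ℕ => PowerSeries.coeff k S * (z / (1 - z)) ^ k)
      ((ω : ℂ)⁻¹ * Complex.exp (∫ ζ : Circle, (1 + (ζ : ℂ) * z) / (1 - (ζ : ℂ) * z) ∂ν))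

/-- `(ω, b, υ)` is the `⊠`-characteristic triplet of `μ`: with `(ω, ν)` the characteristic pair,
`b = 2 ν({1})` and `υ(dζ) = 1_{ζ ≠ 1} (1 - Re ζ)⁻¹ ν(dζ)`. -/
def IsCharTriplet (μ : Measure Circle) (ω : Circle) (b : ℝ) (υ : Measure Circle) : Prop :=
  ∃ ν : Measure Circle, IsCharPair μ ω ν ∧ b = 2 * ν.real {1} ∧
    υ = (ν.restrict {1}ᶜ).withDensity (fun ζ => ENNReal.ofReal (1 / (1 - (ζ : ℂ).re)))

/-! ### The order on the symmetric group -/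

variable {n : ℕ}

/-- `|σ| = n - ℓ(σ)`, where `ℓ(σ)` is the number of cycles of `σ`, fixed points included. -/
def permLength (σ : Equiv.Perm (Fin n)) : ℕ := n - Multiset.card σ.partition.parts

/-- `d(σ, τ) = |σ⁻¹ τ|`. -/
def permDist (σ τ : Equiv.Perm (Fin n)) : ℕ := permLength (σ⁻¹ * τ)

/-- `σ ≼ τ`: the permutation `σ` lies on a geodesic from `1` to `τ`. -/
def PermLE (σ τ : Equiv.Perm (Fin n)) : Prop :=
  permDist 1 σ + permDist σ τ = permDist 1 τ

/-- The relation `σ ≺ τ`. -/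
def strictRel (n : ℕ) : SetRel (Equiv.Perm (Fin n)) (Equiv.Perm (Fin n)) :=
  {p | PermLE p.1 p.2 ∧ p.1 ≠ p.2}

/-- One step of a simple chain: `σ ≺ τ` and `σ⁻¹ τ` is a nontrivial cycle. -/
def simpleRel (n : ℕ) : SetRel (Equiv.Perm (Fin n)) (Equiv.Perm (Fin n)) :=
  {p | (PermLE p.1 p.2 ∧ p.1 ≠ p.2) ∧ (p.1⁻¹ * p.2).IsCycle}

/-- The simple chains `(σ_0, …, σ_l)` in `[1, σ]` with `σ_l = σ`. -/
def simpleChainsTo (σ : Equiv.Perm (Fin n)) : Set (RelSeries (simpleRel n)) :=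
  {Γ | (∀ i, PermLE (Γ i) σ) ∧ Γ.last = σ}

/-- The chains `(σ_0, …, σ_l)` in `[1, (1 ⋯ n)]` with `σ_0 = 1` and `σ_l = (1 ⋯ n)`. Under the
isomorphism sending a noncrossing partition to the product of the increasing cycles on its blocks,
they are the chains in `NC(n)` from `0_n` to `1_n`. -/
def fullChains (n : ℕ) : Set (RelSeries (strictRel n)) :=
  {Γ | (∀ i, PermLE (Γ i) (finRotate n)) ∧ Γ.head = 1 ∧ Γ.last = finRotate n}

/-- `∏_{c cycle of σ} f(#c)`, fixed points being cycles of length one. -/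
def cycleProd (f : ℕ → ℂ) (σ : Equiv.Perm (Fin n)) : ℂ := (σ.partition.parts.map f).prod

/-! ### Free cumulants and free log-cumulants -/

theorem isUnit_coeff_one (μ : Measure Circle) [IsProbabilityMeasure μ] :
    IsUnit (PowerSeries.coeff 1 (PowerSeries.X * momentSeries μ)) := by
  have : PowerSeries.coeff 1 (PowerSeries.X * momentSeries μ) = 1 := by
    rw [show (1 : ℕ) = 0 + 1 from rfl, PowerSeries.coeff_succ_X_mul]
    simp [momentSeries, moment]
  rw [this]
  exact isUnit_one

/-- The free cumulants: the coefficients of `C_μ(z) = M_μ(W_μ(z))`, with `W_μ` the inverse under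
composition of `z M_μ(z)`. -/
def freeCumulant (μ : Measure Circle) [IsProbabilityMeasure μ] (k : ℕ) : ℂ :=
  PowerSeries.coeff k ((momentSeries μ).subst
    ((PowerSeries.X * momentSeries μ).substInvOfIsUnit (isUnit_coeff_one μ)))

/-- The free log-cumulants: `Lκ_1(μ) = Log m_1(μ)` and, for `n ≥ 2`,
`Lκ_n(μ) = ∑_Γ (-1)^{1+|Γ|} / |Γ| ∏_i m_1(μ)^{-n} κ[K_{σ_i}(σ_{i-1})](μ)` over the chains `Γ` in
`NC(n) ≅ [1, (1 ⋯ n)]` from the minimal to the maximal element. The Kreweras complement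
`K_{σ_i}(σ_{i-1})` is `σ_{i-1}⁻¹ σ_i`, and `κ[·]` is the product of the free cumulants over the
blocks, which are the cycles. -/
def freeLogCumulant (μ : Measure Circle) [IsProbabilityMeasure μ] (n : ℕ) : ℂ :=
  if n = 1 then Complex.log (moment μ 1)
  else ∑ᶠ Γ ∈ fullChains n, (-1) ^ (1 + Γ.length) / (Γ.length : ℂ) *
    ∏ i : Fin Γ.length,
      (((moment μ 1) ^ n)⁻¹ * cycleProd (freeCumulant μ) ((Γ i.castSucc)⁻¹ * Γ i.succ))

/-! ### The chain sums above are finite -/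

theorem strictRel_length_le (Γ : RelSeries (strictRel n)) : Γ.length ≤ n := by
  have card_le : ∀ σ : Equiv.Perm (Fin n), Multiset.card σ.partition.parts ≤ n := by
    intro σ
    have h := Multiset.card_nsmul_le_sum (s := σ.partition.parts) (a := 1)
      (fun x hx => σ.partition.parts_pos hx)
    simpa [σ.partition.parts_sum] using h
  have eq_one : ∀ σ : Equiv.Perm (Fin n), permLength σ = 0 → σ = 1 := by
    intro σ h
    have h1 : σ.cycleType.card + (n - σ.support.card) = n := by
      have h2 := card_le σ
      have h3 : Multiset.card σ.partition.parts = σ.cycleType.card + (n - σ.support.card) := by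
        rw [Equiv.Perm.parts_partition]; simp
      unfold permLength at h
      omega
    have h4 : σ.support.card ≤ n := by simpa using Finset.card_le_univ σ.support
    have h5 : 2 * σ.cycleType.card ≤ σ.support.card := by
      have h := Multiset.card_nsmul_le_sum (s := σ.cycleType) (a := 2)
        (fun x hx => Equiv.Perm.two_le_of_mem_cycleType hx)
      rw [Equiv.Perm.sum_cycleType] at h
      simpa [mul_comm] using h
    rw [← Equiv.Perm.card_cycleType_eq_zero]
    omega
  have key : ∀ (k : ℕ) (hk : k < Γ.length + 1), k ≤ permLength (Γ ⟨k, hk⟩) := by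
    intro k
    induction k with
    | zero => intro _; exact Nat.zero_le _
    | succ k ih =>
      intro hk
      have h := Γ.step ⟨k, by omega⟩
      have ih' := ih (by omega)
      obtain ⟨hle, hne⟩ := h
      simp only [PermLE, permDist, inv_one, one_mul, Fin.castSucc_mk, Fin.succ_mk] at hle hne
      have hpos : permLength ((Γ ⟨k, by omega⟩)⁻¹ * Γ ⟨k + 1, hk⟩) ≠ 0 := by
        intro h0
        exact hne (inv_mul_eq_one.mp (eq_one _ h0))
      have hle' : permLength (Γ ⟨k, by omega⟩) +
          permLength ((Γ ⟨k, by omega⟩)⁻¹ * Γ ⟨k + 1, hk⟩) = permLength (Γ ⟨k + 1, hk⟩) := hle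
      omega
  refine (key Γ.length (by omega)).trans ?_
  unfold permLength
  omega

theorem finite_of_length_le {α : Type*} [Finite α] (r : SetRel α α) (N : ℕ)
    (h : ∀ Γ : RelSeries r, Γ.length ≤ N) : Finite (RelSeries r) := by
  let F : RelSeries r → Σ l : Fin (N + 1), (Fin (l + 1) → α) :=
    fun Γ => ⟨⟨Γ.length, Nat.lt_succ_of_le (h Γ)⟩, Γ.toFun⟩
  refine Finite.of_injective F ?_
  rintro ⟨l, f, hf⟩ ⟨l', f', hf'⟩ hF
  simp only [F, Sigma.mk.injEq, Fin.mk.injEq] at hF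
  obtain ⟨rfl, hF⟩ := hF
  obtain rfl := eq_of_heq hF
  rfl

instance finite_strictChains : Finite (RelSeries (strictRel n)) :=
  finite_of_length_le _ n strictRel_length_le

instance finite_simpleChains : Finite (RelSeries (simpleRel n)) :=
  finite_of_length_le _ n fun Γ => strictRel_length_le (Γ.ofLE (s := strictRel n) fun _ h => h.1)

end FreeMul

end

open FreeMul

/-!
The statement only depends on the expansion of the exponent of the characteristic pair. In the
variable `w = z / (1 - z)` it reads `(1 + ζ z) / (1 - ζ z) = 1 + ∑ 2 ζ (ζ - 1)^k w^(k+1)`, and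
`2 ζ (1 - Re ζ) = -(ζ - 1)^2` on the circle, so that `S(w) = m₁⁻¹ exp (-Λ(w))` with
`Λ(w) = ∑_{k ≥ 2} ℓ_k w^(k-1)`, where `ℓ_2 = -b + ∫ (ζ - 1)^2 dυ` and `ℓ_k = ∫ (ζ - 1)^k dυ` for
`k ≥ 3` (`STransform_eq`, `integral_two_mul_sub_one_pow`). It remains to prove, for any such `S`,
that `Lκ_n = ℓ_n` for `n ≥ 2` and that the product formula for moments holds.

Both facts come from one linear flow. Let `L` be the matrix indexed by `𝔖_n` whose entry at `(π, σ)`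
is `ℓ_k` if `π ≼ σ` and `π⁻¹ σ` is a cycle of length `k ≥ 2`, and zero otherwise (`cycleMatrix`).
For a power series `φ` with constant term `1`, let `a(t)` be the coefficients of the compositional
inverse `A_t` of `w / φ_t`, with `φ_t = φ exp (t Λ)`, and let `v_t(σ) = ∏_c a_{#c}(t)`. Then
`v_t' = v_t L` (`hasDerivAt_cycleProd_flowCoeff`):

* By Lagrange inversion, `n [z^n] A^k = k [w^(n-k)] φ^n`, so that
  `a_n' = n ∑_k (ℓ_k / k) [z^n] A_t^k` (`hasDerivAt_flowCoeff`).
* Splitting off a `k`-cycle through a given point `x` along a geodesic amounts to cutting the cycle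
  of `x` successively at `k - 1` points by transpositions, and the lengths of the `k` pieces form an
  arbitrary composition of its length; hence `L` acts on multiplicative functions as a derivation
  with the same right-hand side (`sum_cycleProd_mul_cycleMatrix`).

As `L` is nilpotent, `v_1 = v_0 exp L` (`linearFlow_eq`). For `φ = 1 + w` one has `v_0 = 1` and
`v_1(σ) = m₁^(-n) ∏_c m_{#c}`, and expanding `exp L` gives the sum over simple chains. For `φ = 1`
one has `v_0 = δ_1`, and `v_1` is the normalized multiplicative function `f` of the free cumulants.
Since lengths add up along geodesics, the matrices of the form `[π ≼ σ] x(π⁻¹ σ)` are closed under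
products (`gradedMatrix_mul`), so the matrix `F` of `f` is `exp L`. The chain sum defining `Lκ_n` is
the entry of `log F` at `(1, (1 ⋯ n))`, which is the entry `ℓ_n` of `L` (`sum_fullChains_cumulants`).
-/

/-! ### Cycles of permutations and multiplication by a transposition -/

namespace FreeMul

open Equiv Function

section CycleCount

theorem minimalPeriod_pos_of_perm {α : Type*} [Finite α] (σ : Perm α) (x : α) :
    0 < minimalPeriod σ x := by
  refine minimalPeriod_pos_of_mem_periodicPts ⟨orderOf σ, orderOf_pos σ, ?_⟩
  rw [IsPeriodicPt, IsFixedPt, ← Perm.coe_pow, pow_orderOf_eq_one]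
  rfl

theorem pow_inj_of_lt_minimalPeriod {α : Type*} {σ : Perm α} {x : α} {i j : ℕ}
    (hi : i < minimalPeriod σ x) (hj : j < minimalPeriod σ x) (h : (σ ^ i) x = (σ ^ j) x) : i = j := by
  rw [Perm.coe_pow, Perm.coe_pow] at h
  exact (iterate_eq_iterate_iff_of_lt_minimalPeriod hi hj).1 h

variable {α : Type*} [Fintype α] [DecidableEq α]

theorem minimalPeriod_eq_card_support_cycleOf (σ : Perm α) {x : α} (hx : σ x ≠ x) :
    minimalPeriod σ x = (σ.cycleOf x).support.card := by
  have hc := σ.isCycleOn_support_cycleOf x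
  have hmem : x ∈ (σ.cycleOf x).support := by
    rw [Perm.mem_support_cycleOf_iff' hx]
  apply Nat.dvd_antisymm
  · refine IsPeriodicPt.minimalPeriod_dvd ?_
    rw [IsPeriodicPt, IsFixedPt, ← Perm.coe_pow]
    exact hc.pow_card_apply hmem
  · rw [← hc.pow_apply_eq hmem, Perm.coe_pow]
    exact isPeriodicPt_minimalPeriod σ x

/-- The points lying on a cycle of length `p` number `p` times the multiplicity of `p` in the
cycle partition. -/
theorem mul_count_parts (σ : Perm α) (p : ℕ) :
    p * σ.partition.parts.count p = (Finset.univ.filter fun x => minimalPeriod σ x = p).card := by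
  classical
  rw [← Finset.card_filter_add_card_filter_not (s := Finset.univ.filter _) (fun x => x ∈ σ.support),
    Perm.parts_partition, Multiset.count_add, mul_add]
  congr 1
  · rw [Perm.cycleType_def, Multiset.count_map, ← smul_eq_mul, smul_eq_mul]
    rw [Finset.card_eq_sum_card_fiberwise (f := σ.cycleOf)
      (t := σ.cycleFactorsFinset.filter fun c => p = c.support.card)]
    · have : ∀ c ∈ σ.cycleFactorsFinset.filter fun c => p = c.support.card,
          (((Finset.univ.filter fun x => minimalPeriod σ x = p).filter
            (fun x => x ∈ σ.support)).filter fun x => σ.cycleOf x = c).card = p := by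
        intro c hc
        obtain ⟨hc, hp⟩ := Finset.mem_filter.1 hc
        conv_rhs => rw [hp]
        congr 1
        ext x
        simp only [Finset.mem_filter, Finset.mem_univ, true_and]
        constructor
        · rintro ⟨⟨h1, h2⟩, h3⟩
          rw [← h3, Perm.mem_support_cycleOf_iff' (Perm.mem_support.1 h2)]
        · intro hx
          have h2 : x ∈ σ.support := Perm.mem_cycleFactorsFinset_support_le hc hx
          have h3 := Perm.cycle_is_cycleOf hx hc
          refine ⟨⟨?_, h2⟩, h3.symm⟩
          rw [minimalPeriod_eq_card_support_cycleOf σ (Perm.mem_support.1 h2), ← h3, hp]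
      rw [Finset.sum_congr rfl this, Finset.sum_const, smul_eq_mul, mul_comm]
      rfl
    · intro x hx
      simp only [Finset.coe_filter, Finset.mem_filter, Finset.mem_univ, true_and,
        Set.mem_ofPred_eq] at hx ⊢
      exact ⟨Perm.cycleOf_mem_cycleFactorsFinset_iff.2 hx.2,
        hx.1.symm.trans (minimalPeriod_eq_card_support_cycleOf σ (Perm.mem_support.1 hx.2))⟩
  · rw [Multiset.count_replicate]
    have key : ∀ x, x ∉ σ.support ↔ minimalPeriod σ x = 1 := by
      intro x
      rw [minimalPeriod_eq_one_iff_isFixedPt, Perm.notMem_support]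
      rfl
    by_cases hp : p = 1
    · subst hp
      simp only [key, if_true, one_mul, Finset.filter_filter, and_self]
      rw [← Finset.card_compl]
      congr 1
      ext x
      simp [← key]
    · rw [if_neg (fun h => hp h.symm), mul_zero, eq_comm, Finset.card_eq_zero,
        Finset.filter_eq_empty_iff]
      intro x hx
      rw [key]
      simp only [Finset.mem_filter, Finset.mem_univ, true_and] at hx
      omega

theorem card_sameCycle (σ : Perm α) (x : α) :
    (Finset.univ.filter fun z => σ.SameCycle x z).card = minimalPeriod σ x := by
  by_cases hx : σ x = x
  · rw [minimalPeriod_eq_one_iff_isFixedPt.2 hx, Finset.card_eq_one]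
    refine ⟨x, ?_⟩
    ext z
    simp only [Finset.mem_filter, Finset.mem_univ, true_and, Finset.mem_singleton]
    exact ⟨fun h => (h.eq_of_left hx).symm, fun h => h ▸ Perm.SameCycle.rfl⟩
  · rw [minimalPeriod_eq_card_support_cycleOf σ hx]
    congr 1
    ext z
    simp [Perm.mem_support_cycleOf_iff' hx]

theorem minimalPeriod_sameCycle {σ : Perm α} {x z : α} (h : σ.SameCycle x z) :
    minimalPeriod σ z = minimalPeriod σ x := by
  rw [← card_sameCycle, ← card_sameCycle]
  congr 1
  ext w
  simp only [Finset.mem_filter, Finset.mem_univ, true_and]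
  exact ⟨fun h' => h.trans h', fun h' => h.symm.trans h'⟩

theorem sameCycle_exists_pow_lt {α : Type*} [Finite α] {σ : Perm α} {x z : α} (h : σ.SameCycle x z) :
    ∃ i < minimalPeriod σ x, (σ ^ i) x = z := by
  obtain ⟨i, hi⟩ := h.exists_nat_pow_eq
  refine ⟨i % minimalPeriod σ x, Nat.mod_lt _ (minimalPeriod_pos_of_perm σ x), ?_⟩
  rw [Perm.coe_pow, iterate_mod_minimalPeriod_eq, ← Perm.coe_pow, hi]

section Split

variable {σ : Perm α} {x : α} {i : ℕ}

/-- Multiplying by the transposition of `x` and `σ^i x` cuts the cycle of `x`: the piece of `x` is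
`x, σ^(i+1) x, σ^(i+2) x, …`. -/
theorem mul_swap_pow_left {α : Type*} [DecidableEq α] {σ : Perm α} {x : α} {i : ℕ}
    (hi : i < minimalPeriod σ x) {j : ℕ}
    (hj : 1 ≤ j) (hj' : j + i ≤ minimalPeriod σ x) :
    ((σ * swap x ((σ ^ i) x)) ^ j) x = (σ ^ (j + i)) x := by
  induction j, hj using Nat.le_induction with
  | base => simp [pow_add]
  | succ j hj ih =>
    rw [pow_succ', Perm.mul_apply, ih (by omega), Perm.mul_apply, swap_apply_of_ne_of_ne,
      ← Perm.mul_apply, ← pow_succ']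
    · congr 2; omega
    · intro h
      have := pow_inj_of_lt_minimalPeriod (j := 0) (by omega) (by omega) h
      omega
    · intro h
      have := pow_inj_of_lt_minimalPeriod (by omega) (by omega) h
      omega

/-- The other piece of the cut cycle is `σ^i x, σ x, …, σ^(i-1) x`. -/
theorem mul_swap_pow_right {α : Type*} [DecidableEq α] {σ : Perm α} {x : α} {i : ℕ}
    (hi : i < minimalPeriod σ x) {j : ℕ}
    (hj : 1 ≤ j) (hj' : j ≤ i) :
    ((σ * swap x ((σ ^ i) x)) ^ j) ((σ ^ i) x) = (σ ^ j) x := by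
  induction j, hj using Nat.le_induction with
  | base => simp
  | succ j hj ih =>
    rw [pow_succ', Perm.mul_apply, ih (by omega), Perm.mul_apply, swap_apply_of_ne_of_ne,
      ← Perm.mul_apply, ← pow_succ']
    · intro h
      have := pow_inj_of_lt_minimalPeriod (j := 0) (by omega) (by omega) h
      omega
    · intro h
      have := pow_inj_of_lt_minimalPeriod (by omega) (by omega) h
      omega

theorem minimalPeriod_eq_of_pow {α : Type*} [Finite α] {τ : Perm α} {y : α} {N : ℕ} (hN : 0 < N)
    (h : (τ ^ N) y = y)
    (h' : ∀ j, 1 ≤ j → j < N → (τ ^ j) y ≠ y) : minimalPeriod τ y = N := by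
  have h1 : minimalPeriod τ y ≤ N := IsPeriodicPt.minimalPeriod_le hN (by
    rw [IsPeriodicPt, IsFixedPt, ← Perm.coe_pow, h])
  have h0 := minimalPeriod_pos_of_perm τ y
  rcases h1.lt_or_eq with h2 | h2
  · refine absurd ?_ (h' _ h0 h2)
    rw [Perm.coe_pow]
    exact isPeriodicPt_minimalPeriod τ y
  · exact h2

theorem minimalPeriod_mul_swap_left (h0 : 0 < i) (hi : i < minimalPeriod σ x) :
    minimalPeriod (σ * swap x ((σ ^ i) x)) x = minimalPeriod σ x - i := by
  refine minimalPeriod_eq_of_pow (by omega) ?_ fun j h1 h2 => ?_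
  · rw [mul_swap_pow_left hi (by omega) (by omega), Nat.sub_add_cancel hi.le, Perm.coe_pow]
    exact isPeriodicPt_minimalPeriod σ x
  · rw [mul_swap_pow_left hi (by omega) (by omega)]
    intro h
    have := pow_inj_of_lt_minimalPeriod (j := 0) (by omega) (by omega) h
    omega

theorem minimalPeriod_mul_swap_right (h0 : 0 < i) (hi : i < minimalPeriod σ x) :
    minimalPeriod (σ * swap x ((σ ^ i) x)) ((σ ^ i) x) = i := by
  refine minimalPeriod_eq_of_pow (by omega) ?_ fun j h1 h2 => ?_
  · rw [mul_swap_pow_right hi (by omega) (by omega)]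
  · rw [mul_swap_pow_right hi (by omega) (by omega)]
    intro h
    have := pow_inj_of_lt_minimalPeriod (by omega) (by omega) h
    omega

/-- The two pieces together make up the cycle of `x` in `σ`. -/
theorem sameCycle_mul_swap_iff (h0 : 0 < i) (hi : i < minimalPeriod σ x) (z : α) :
    σ.SameCycle x z ↔ (σ * swap x ((σ ^ i) x)).SameCycle x z ∨
      (σ * swap x ((σ ^ i) x)).SameCycle ((σ ^ i) x) z := by
  constructor
  · intro h
    obtain ⟨j, hj, rfl⟩ := sameCycle_exists_pow_lt h
    rcases Nat.eq_zero_or_pos j with rfl | hj0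
    · left; exact Perm.SameCycle.rfl
    rcases le_or_gt j i with hji | hji
    · right
      exact ⟨j, by simpa using mul_swap_pow_right hi hj0 hji⟩
    · left
      refine ⟨(j - i : ℕ), ?_⟩
      rw [zpow_natCast, mul_swap_pow_left hi (by omega) (by omega), Nat.sub_add_cancel hji.le]
  · have hx : minimalPeriod (σ * swap x ((σ ^ i) x)) x = minimalPeriod σ x - i :=
      minimalPeriod_mul_swap_left h0 hi
    have hy : minimalPeriod (σ * swap x ((σ ^ i) x)) ((σ ^ i) x) = i :=
      minimalPeriod_mul_swap_right h0 hi
    rintro (h | h)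
    · obtain ⟨j, hj, rfl⟩ := sameCycle_exists_pow_lt h
      rcases Nat.eq_zero_or_pos j with rfl | hj0
      · exact Perm.SameCycle.rfl
      rw [mul_swap_pow_left hi hj0 (by omega)]
      exact ⟨(j + i : ℕ), by rw [zpow_natCast]⟩
    · obtain ⟨j, hj, rfl⟩ := sameCycle_exists_pow_lt h
      rcases Nat.eq_zero_or_pos j with rfl | hj0
      · exact ⟨i, by simp⟩
      rw [mul_swap_pow_right hi hj0 (by omega)]
      exact ⟨j, by rw [zpow_natCast]⟩

theorem not_sameCycle_mul_swap (h0 : 0 < i) (hi : i < minimalPeriod σ x) :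
    ¬ (σ * swap x ((σ ^ i) x)).SameCycle x ((σ ^ i) x) := by
  intro h
  have h1 := card_sameCycle (σ * swap x ((σ ^ i) x)) x
  rw [minimalPeriod_mul_swap_left h0 hi] at h1
  have h2 := card_sameCycle σ x
  have : ∀ z, σ.SameCycle x z ↔ (σ * swap x ((σ ^ i) x)).SameCycle x z := fun z =>
    (sameCycle_mul_swap_iff h0 hi z).trans ⟨fun h' => h'.elim id h.trans, Or.inl⟩
  simp only [this] at h2
  omega

theorem minimalPeriod_mul_swap_of_not_sameCycle {z : α} (hz : ¬ σ.SameCycle x z) :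
    minimalPeriod (σ * swap x ((σ ^ i) x)) z = minimalPeriod σ z := by
  have key : ∀ j : ℕ, ((σ * swap x ((σ ^ i) x)) ^ j) z = (σ ^ j) z := by
    intro j
    induction j with
    | zero => rfl
    | succ j ih =>
      rw [pow_succ', Perm.mul_apply, ih, Perm.mul_apply, swap_apply_of_ne_of_ne,
        ← Perm.mul_apply, ← pow_succ']
      · intro h
        exact hz ((Perm.SameCycle.symm ⟨(j : ℤ), by rw [zpow_natCast, h]⟩))
      · intro h
        refine hz (Perm.SameCycle.trans (y := (σ ^ i) x) ⟨(i : ℤ), by rw [zpow_natCast]⟩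
          (Perm.SameCycle.symm ⟨(j : ℤ), by rw [zpow_natCast, h]⟩))
  refine minimalPeriod_eq_of_pow (minimalPeriod_pos_of_perm σ z) ?_ fun j h1 h2 => ?_
  · rw [key, Perm.coe_pow]
    exact isPeriodicPt_minimalPeriod σ z
  · rw [key]
    intro h
    have := pow_inj_of_lt_minimalPeriod (j := 0) h2 (by omega) h
    omega

/-- Multiplying by the transposition of two points of one cycle cuts that cycle in two. -/
theorem parts_mul_swap (h0 : 0 < i) (hi : i < minimalPeriod σ x) :
    (σ * swap x ((σ ^ i) x)).partition.parts + {minimalPeriod σ x} =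
      σ.partition.parts + {i, minimalPeriod σ x - i} := by
  ext p
  rcases Nat.eq_zero_or_pos p with rfl | hp
  · have h1 : ∀ τ : Perm α, (τ.partition.parts).count 0 = 0 := fun τ =>
      Multiset.count_eq_zero.2 fun h => absurd (τ.partition.parts_pos h) (lt_irrefl 0)
    have h2 := minimalPeriod_pos_of_perm σ x
    simp only [Multiset.count_add, h1, Multiset.insert_eq_cons, Multiset.count_cons,
      Multiset.count_singleton]
    rw [if_neg (by omega), if_neg (by omega), if_neg (by omega)]
  refine Nat.eq_of_mul_eq_mul_left hp ?_
  simp only [Multiset.count_add, mul_add, mul_count_parts]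
  set σ' := σ * swap x ((σ ^ i) x) with hσ'
  -- compare the points on the cycle of `x` and the points off it
  have split : ∀ τ : Perm α, (Finset.univ.filter fun z => minimalPeriod τ z = p).card =
      (Finset.univ.filter fun z => σ.SameCycle x z ∧ minimalPeriod τ z = p).card +
      (Finset.univ.filter fun z => ¬ σ.SameCycle x z ∧ minimalPeriod τ z = p).card := by
    intro τ
    rw [← Finset.card_filter_add_card_filter_not (s := Finset.univ.filter _)
      (fun z => σ.SameCycle x z), Finset.filter_filter, Finset.filter_filter]
    simp only [and_comm]
  have outside : (Finset.univ.filter fun z => ¬ σ.SameCycle x z ∧ minimalPeriod σ' z = p) =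
      (Finset.univ.filter fun z => ¬ σ.SameCycle x z ∧ minimalPeriod σ z = p) := by
    ext z
    simp only [Finset.mem_filter, Finset.mem_univ, true_and]
    refine and_congr_right fun hz => ?_
    rw [hσ', minimalPeriod_mul_swap_of_not_sameCycle hz]
  have const : ∀ (τ : Perm α) (y : α),
      (Finset.univ.filter fun z => τ.SameCycle y z ∧ minimalPeriod τ z = p).card =
        p * if p = minimalPeriod τ y then 1 else 0 := by
    intro τ y
    split_ifs with h
    · rw [h, mul_one, ← card_sameCycle]
      congr 1
      ext z
      simp only [Finset.mem_filter, Finset.mem_univ, true_and, and_iff_left_iff_imp]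
      exact fun hz => (minimalPeriod_sameCycle hz).trans (card_sameCycle τ y).symm
    · rw [mul_zero, Finset.card_eq_zero, Finset.filter_eq_empty_iff]
      rintro z - ⟨hz, hz'⟩
      exact h (hz'.symm.trans (minimalPeriod_sameCycle hz))
  have inside : (Finset.univ.filter fun z => σ.SameCycle x z ∧ minimalPeriod σ' z = p).card =
      (Finset.univ.filter fun z => σ'.SameCycle x z ∧ minimalPeriod σ' z = p).card +
      (Finset.univ.filter fun z => σ'.SameCycle ((σ ^ i) x) z ∧ minimalPeriod σ' z = p).card := by
    rw [← Finset.card_union_of_disjoint]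
    · congr 1
      ext z
      simp only [Finset.mem_filter, Finset.mem_univ, true_and, Finset.mem_union,
        sameCycle_mul_swap_iff h0 hi z, ← hσ', or_and_right]
    · rw [Finset.disjoint_filter]
      rintro z - ⟨h1, -⟩ ⟨h2, -⟩
      exact not_sameCycle_mul_swap h0 hi (h1.trans h2.symm)
  rw [split σ', split σ, outside, inside, const, const, const, hσ', minimalPeriod_mul_swap_left h0 hi,
    minimalPeriod_mul_swap_right h0 hi]
  simp only [Multiset.insert_eq_cons, Multiset.count_cons, Multiset.count_singleton]
  ring

end Split

end CycleCount

end FreeMul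

/-! ### Removing a cycle along a geodesic -/

namespace FreeMul

open Equiv Function

section Geodesic

variable {n : ℕ}

theorem card_parts_le (σ : Perm (Fin n)) : Multiset.card σ.partition.parts ≤ n := by
  have h := Multiset.card_nsmul_le_sum (s := σ.partition.parts) (a := 1)
    (fun x hx => σ.partition.parts_pos hx)
  simpa [σ.partition.parts_sum] using h

theorem permLength_add_card (σ : Perm (Fin n)) :
    permLength σ + Multiset.card σ.partition.parts = n :=
  Nat.sub_add_cancel (card_parts_le σ)

theorem permLength_one : permLength (1 : Perm (Fin n)) = 0 := by
  unfold permLength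
  rw [Perm.parts_partition]
  simp

theorem permLength_inv (σ : Perm (Fin n)) : permLength σ⁻¹ = permLength σ := by
  unfold permLength
  rw [Perm.parts_partition, Perm.parts_partition, Perm.cycleType_inv, Perm.support_inv]

theorem permLength_mul_swap_of_sameCycle {σ : Perm (Fin n)} {x y : Fin n} (h : σ.SameCycle x y)
    (hxy : x ≠ y) : permLength (σ * swap x y) + 1 = permLength σ := by
  obtain ⟨i, hi, rfl⟩ := sameCycle_exists_pow_lt h
  have h0 : 0 < i := Nat.pos_of_ne_zero fun h0 => hxy (by simp [h0])
  have := congrArg Multiset.card (parts_mul_swap h0 hi)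
  simp only [Multiset.card_add, Multiset.card_singleton, Multiset.insert_eq_cons,
    Multiset.card_cons] at this
  have h1 := permLength_add_card σ
  have h2 := permLength_add_card (σ * swap x ((σ ^ i) x))
  omega

theorem sameCycle_mul_swap_of_not_sameCycle {σ : Perm (Fin n)} {x y : Fin n}
    (h : ¬ σ.SameCycle x y) : (σ * swap x y).SameCycle x y := by
  have key : ∀ j, 1 ≤ j → j ≤ minimalPeriod σ x → ((σ * swap x y) ^ j) y = (σ ^ j) x := by
    intro j hj
    induction j, hj using Nat.le_induction with
    | base => simp
    | succ j hj ih =>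
      intro hj'
      rw [pow_succ', Perm.mul_apply, ih (by omega), Perm.mul_apply, swap_apply_of_ne_of_ne,
        ← Perm.mul_apply, ← pow_succ']
      · intro h'
        have := pow_inj_of_lt_minimalPeriod (j := 0) (by omega) (by omega) h'
        omega
      · intro h'
        exact h ⟨(j : ℤ), by rw [zpow_natCast, h']⟩
  have h1 := key _ (minimalPeriod_pos_of_perm σ x) le_rfl
  refine Perm.SameCycle.symm ⟨(minimalPeriod σ x : ℤ), ?_⟩
  rw [zpow_natCast, h1, Perm.coe_pow]
  exact isPeriodicPt_minimalPeriod σ x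

theorem permLength_mul_swap_of_not_sameCycle {σ : Perm (Fin n)} {x y : Fin n}
    (h : ¬ σ.SameCycle x y) : permLength (σ * swap x y) = permLength σ + 1 := by
  have h1 := permLength_mul_swap_of_sameCycle (sameCycle_mul_swap_of_not_sameCycle h)
    (fun hxy => h (hxy ▸ Perm.SameCycle.rfl))
  rw [mul_assoc, swap_mul_self, mul_one] at h1
  exact h1.symm

theorem permLength_mul_swap_apply (σ : Perm (Fin n)) {x : Fin n} (hx : σ x ≠ x) :
    permLength (σ * swap x (σ x)) + 1 = permLength σ :=
  permLength_mul_swap_of_sameCycle ⟨1, by simp⟩ hx.symm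

theorem permLength_eq_zero_iff {σ : Perm (Fin n)} : permLength σ = 0 ↔ σ = 1 := by
  refine ⟨fun h => ?_, fun h => h ▸ permLength_one⟩
  ext1 x
  by_contra hx
  have := permLength_mul_swap_apply σ hx
  omega

/-- Subadditivity of the length. It suffices to multiply by transpositions, each of which changes the
length by at most one. -/
theorem permLength_mul_le (σ τ : Perm (Fin n)) :
    permLength (σ * τ) ≤ permLength σ + permLength τ := by
  induction h : permLength τ generalizing τ with
  | zero => rw [permLength_eq_zero_iff.1 h]; simp
  | succ k ih =>
    obtain ⟨x, hx⟩ : ∃ x, τ x ≠ x := by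
      by_contra! hc
      rw [show τ = 1 from Perm.ext hc, permLength_one] at h
      omega
    have h1 := permLength_mul_swap_apply τ hx
    have h2 := ih (τ * swap x (τ x)) (by omega)
    rw [← mul_assoc] at h2
    by_cases hs : (σ * τ).SameCycle x (τ x)
    · have := permLength_mul_swap_of_sameCycle hs hx.symm
      omega
    · have := permLength_mul_swap_of_not_sameCycle hs
      omega

theorem permLE_iff {π σ : Perm (Fin n)} :
    PermLE π σ ↔ permLength π + permLength (π⁻¹ * σ) = permLength σ := by
  simp [PermLE, permDist]

theorem permLength_le_of_mid (π ρ σ : Perm (Fin n)) :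
    permLength (π⁻¹ * σ) ≤ permLength (π⁻¹ * ρ) + permLength (ρ⁻¹ * σ) := by
  simpa [mul_assoc] using permLength_mul_le (π⁻¹ * ρ) (ρ⁻¹ * σ)

theorem permLength_le_add (π σ : Perm (Fin n)) :
    permLength σ ≤ permLength π + permLength (π⁻¹ * σ) := by
  simpa using permLength_mul_le π (π⁻¹ * σ)

/-- The length is additive along both ways of refining a geodesic. -/
theorem permLE_trans_iff {π ρ σ : Perm (Fin n)} :
    PermLE π ρ ∧ PermLE ρ σ ↔ PermLE π σ ∧ PermLE (π⁻¹ * ρ) (π⁻¹ * σ) := by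
  simp only [permLE_iff]
  have h1 := permLength_le_of_mid π ρ σ
  have h2 := permLength_le_add π ρ
  have h3 := permLength_le_add π σ
  have h4 := permLength_le_add ρ σ
  rw [show (π⁻¹ * ρ)⁻¹ * (π⁻¹ * σ) = ρ⁻¹ * σ by group]
  omega

theorem permLE_refl (σ : Perm (Fin n)) : PermLE σ σ := by
  rw [permLE_iff]; simp [permLength_one]

theorem one_permLE (σ : Perm (Fin n)) : PermLE 1 σ := by
  rw [permLE_iff]; simp [permLength_one]

theorem isCycle_permLength {τ : Perm (Fin n)} (h : τ.IsCycle) :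
    permLength τ + 1 = τ.support.card := by
  have h1 : τ.support.card ≤ n := by simpa using Finset.card_le_univ τ.support
  have h2 := h.two_le_card_support
  unfold permLength
  rw [Perm.parts_partition, h.cycleType]
  simp only [Multiset.card_add, Multiset.card_singleton, Multiset.card_replicate, Fintype.card_fin]
  omega

/-- `τ` is the identity or a single cycle through `x`. -/
def IsCycleThrough (x : Fin n) (τ : Perm (Fin n)) : Prop := τ = 1 ∨ (τ.IsCycle ∧ τ x ≠ x)

open Classical in
/-- The cycles `τ` of length `k + 1` through `x` (the identity if `k = 0`) that can be split off
`σ` on the right along a geodesic. -/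
noncomputable def geodesicCycles (k : ℕ) (σ : Perm (Fin n)) (x : Fin n) : Finset (Perm (Fin n)) :=
  Finset.univ.filter fun τ => IsCycleThrough x τ ∧ permLength τ = k ∧
    permLength (σ * τ⁻¹) + permLength τ = permLength σ

theorem mem_geodesicCycles {k : ℕ} {σ τ : Perm (Fin n)} {x : Fin n} :
    τ ∈ geodesicCycles k σ x ↔ IsCycleThrough x τ ∧ permLength τ = k ∧
      permLength (σ * τ⁻¹) + permLength τ = permLength σ := by
  simp [geodesicCycles]

theorem geodesicCycles_zero (σ : Perm (Fin n)) (x : Fin n) : geodesicCycles 0 σ x = {1} := by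
  ext τ
  rw [mem_geodesicCycles, Finset.mem_singleton, permLength_eq_zero_iff]
  constructor
  · exact fun h => h.2.1
  · rintro rfl
    exact ⟨Or.inl rfl, rfl, by simp [permLength_one]⟩

/-- Shortening a cycle through `x` by one. -/
theorem mul_swap_mem_geodesicCycles {k : ℕ} {σ τ : Perm (Fin n)} {x : Fin n}
    (h : τ ∈ geodesicCycles (k + 1) σ x) :
    σ.SameCycle x (τ x) ∧ τ x ≠ x ∧
      τ * swap x (τ x) ∈ geodesicCycles k (σ * swap x (τ x)) x := by
  obtain ⟨h1, h2, h3⟩ := mem_geodesicCycles.1 h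
  rcases h1 with rfl | ⟨hc, hx⟩
  · rw [permLength_one] at h2; omega
  have h4 := permLength_mul_swap_apply τ hx
  have h5 : σ * swap x (τ x) * (τ * swap x (τ x))⁻¹ = σ * τ⁻¹ := by
    rw [mul_inv_rev, swap_inv, mul_assoc, ← mul_assoc (swap x (τ x)), swap_mul_self, one_mul]
  have h6 := permLength_mul_le (σ * τ⁻¹) (τ * swap x (τ x))
  rw [show σ * τ⁻¹ * (τ * swap x (τ x)) = σ * swap x (τ x) by group] at h6
  have hs : σ.SameCycle x (τ x) := by
    by_contra hs
    have := permLength_mul_swap_of_not_sameCycle hs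
    omega
  have h7 := permLength_mul_swap_of_sameCycle hs hx.symm
  refine ⟨hs, hx, mem_geodesicCycles.2 ⟨?_, by omega, by rw [h5]; omega⟩⟩
  have h8 : τ * swap x (τ x) = swap (τ x) (τ (τ x)) * τ := by
    rw [Equiv.swap_apply_apply]; group
  by_cases h9 : τ (τ x) = x
  · left
    have := hc.eq_swap_of_apply_apply_eq_self hx h9
    nth_rewrite 1 [this]
    exact swap_mul_self _ _
  · right
    refine ⟨?_, ?_⟩
    · rw [h8]
      refine hc.swap_mul (fun h => hx (τ.injective h)) fun h => h9 (τ.injective h)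
    · simpa using h9

theorem sameCycle_of_mem_geodesicCycles {k : ℕ} {σ τ : Perm (Fin n)} {x z : Fin n}
    (h : τ ∈ geodesicCycles k σ x) (hz : τ z ≠ z) : σ.SameCycle x z := by
  induction k generalizing σ τ with
  | zero =>
    rw [geodesicCycles_zero, Finset.mem_singleton] at h
    rw [h] at hz
    exact absurd rfl hz
  | succ k ih =>
    obtain ⟨h1, h2, h3⟩ := mul_swap_mem_geodesicCycles h
    rcases eq_or_ne z x with rfl | hzx
    · exact Perm.SameCycle.rfl
    rcases eq_or_ne z (τ x) with rfl | hzy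
    · exact h1
    have h4 := ih h3 (by rwa [Perm.mul_apply, swap_apply_of_ne_of_ne hzx hzy])
    obtain ⟨i, hi, hi'⟩ := sameCycle_exists_pow_lt h1
    rw [← hi'] at h4
    refine (sameCycle_mul_swap_iff (Nat.pos_of_ne_zero ?_) hi z).2 (Or.inl h4)
    rintro rfl
    exact h2 hi'.symm

/-- Lengthening a cycle through `x` by one. -/
theorem mul_swap_mem_geodesicCycles_succ {k : ℕ} {σ τ : Perm (Fin n)} {x y : Fin n}
    (hs : σ.SameCycle x y) (hxy : y ≠ x) (h : τ ∈ geodesicCycles k (σ * swap x y) x) :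
    τ y = y ∧ τ * swap x y ∈ geodesicCycles (k + 1) σ x := by
  have hy : τ y = y := by
    by_contra hy
    obtain ⟨i, hi, rfl⟩ := sameCycle_exists_pow_lt hs
    have h0 : 0 < i := Nat.pos_of_ne_zero fun h0 => hxy (by simp [h0])
    exact not_sameCycle_mul_swap h0 hi (sameCycle_of_mem_geodesicCycles h hy)
  refine ⟨hy, ?_⟩
  obtain ⟨h1, h2, h3⟩ := mem_geodesicCycles.1 h
  have hns : ¬ τ.SameCycle x y := fun hxy' => hxy (hxy'.symm.eq_of_left hy)
  have h4 := permLength_mul_swap_of_not_sameCycle hns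
  have h5 : σ * swap x y * τ⁻¹ = σ * (τ * swap x y)⁻¹ := by
    rw [mul_inv_rev, swap_inv, mul_assoc]
  have h7 := permLength_mul_swap_of_sameCycle hs hxy.symm
  rw [h5] at h3
  refine mem_geodesicCycles.2 ⟨Or.inr ⟨?_, by simpa [hy] using hxy⟩, by omega, by omega⟩
  rcases h1 with rfl | ⟨hc, hx⟩
  · rw [one_mul]; exact Perm.isCycle_swap hxy.symm
  · refine ⟨x, by simpa [hy] using hxy, fun w hw => ?_⟩
    have hs' := sameCycle_mul_swap_of_not_sameCycle hns
    rcases eq_or_ne w x with rfl | hwx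
    · exact Perm.SameCycle.rfl
    rcases eq_or_ne w y with rfl | hwy
    · exact hs'
    have h8 : τ.SameCycle x w := hc.sameCycle hx (by
      rwa [Perm.mul_apply, swap_apply_of_ne_of_ne hwx hwy] at hw)
    obtain ⟨i, hi, hi'⟩ := sameCycle_exists_pow_lt hs'
    refine (sameCycle_mul_swap_iff (Nat.pos_of_ne_zero ?_) hi w).2 (Or.inl ?_)
    · rintro rfl
      exact hxy hi'.symm
    · rwa [hi', mul_assoc, swap_mul_self, mul_one]

open Classical in
/-- A cycle `τ` in `geodesicCycles (k + 1) σ x` amounts to the choice of the point `y = τ x` in the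
cycle of `x`, followed by the choice of a cycle below `σ * swap x y`. -/
theorem sum_geodesicCycles_succ (g : Perm (Fin n) → ℂ) (k : ℕ) (σ : Perm (Fin n)) (x : Fin n) :
    ∑ τ ∈ geodesicCycles (k + 1) σ x, g (σ * τ⁻¹) =
      ∑ y ∈ Finset.univ.filter fun y => σ.SameCycle x y ∧ y ≠ x,
        ∑ τ ∈ geodesicCycles k (σ * swap x y) x, g (σ * swap x y * τ⁻¹) := by
  rw [Finset.sum_sigma']
  refine Finset.sum_bij' (fun τ _ => ⟨τ x, τ * swap x (τ x)⟩) (fun p _ => p.2 * swap x p.1)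
    ?_ ?_ ?_ ?_ ?_
  · intro τ h
    obtain ⟨h1, h2, h3⟩ := mul_swap_mem_geodesicCycles h
    simpa using ⟨⟨h1, h2⟩, h3⟩
  · rintro ⟨y, τ⟩ h
    simp only [Finset.mem_sigma, Finset.mem_filter, Finset.mem_univ, true_and] at h
    exact (mul_swap_mem_geodesicCycles_succ h.1.1 h.1.2 h.2).2
  · intro τ _
    rw [mul_assoc, swap_mul_self, mul_one]
  · rintro ⟨y, τ⟩ h
    simp only [Finset.mem_sigma, Finset.mem_filter, Finset.mem_univ, true_and] at h
    have := (mul_swap_mem_geodesicCycles_succ h.1.1 h.1.2 h.2).1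
    simp only [Perm.mul_apply, swap_apply_left, this, mul_assoc, swap_mul_self, mul_one]
  · intro τ _
    rw [mul_inv_rev, swap_inv, mul_assoc, ← mul_assoc (swap x (τ x)), swap_mul_self, one_mul]

end Geodesic

end FreeMul

/-! ### Multiplicative functions and the generator -/

namespace FreeMul

open Equiv Function

section CycleSums

variable {n : ℕ}

/-- The product of `a` over the lengths of the cycles of `σ`, one cycle of length `p` omitted. -/
noncomputable def cycleProdErase (a : ℕ → ℂ) (σ : Perm (Fin n)) (p : ℕ) : ℂ :=
  ((σ.partition.parts.erase p).map a).prod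

theorem minimalPeriod_mem_parts (σ : Perm (Fin n)) (x : Fin n) :
    minimalPeriod σ x ∈ σ.partition.parts := by
  have h := mul_count_parts σ (minimalPeriod σ x)
  have h1 : 0 < (Finset.univ.filter fun z => minimalPeriod σ z = minimalPeriod σ x).card :=
    Finset.card_pos.2 ⟨x, by simp⟩
  rw [← Multiset.count_pos]
  exact Nat.pos_of_ne_zero fun h0 => by rw [h0] at h; omega

theorem cycleProdErase_mul_swap (a : ℕ → ℂ) {σ : Perm (Fin n)} {x : Fin n} {i : ℕ}
    (h0 : 0 < i) (hi : i < minimalPeriod σ x) :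
    cycleProdErase a (σ * swap x ((σ ^ i) x)) (minimalPeriod σ x - i) =
      a i * cycleProdErase a σ (minimalPeriod σ x) := by
  have h := parts_mul_swap h0 hi
  have h1 := Multiset.cons_erase (minimalPeriod_mem_parts σ x)
  have h2 : (σ * swap x ((σ ^ i) x)).partition.parts.erase (minimalPeriod σ x - i) =
      i ::ₘ σ.partition.parts.erase (minimalPeriod σ x) := by
    have h3 : (σ * swap x ((σ ^ i) x)).partition.parts =
        (minimalPeriod σ x - i) ::ₘ i ::ₘ σ.partition.parts.erase (minimalPeriod σ x) := by
      refine Multiset.cons_inj_right (minimalPeriod σ x) |>.1 ?_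
      rw [← Multiset.singleton_add, add_comm, h]
      nth_rewrite 1 [← h1]
      simp only [Multiset.insert_eq_cons, ← Multiset.singleton_add]
      abel
    rw [h3, Multiset.erase_cons_head]
  rw [cycleProdErase, h2, Multiset.map_cons, Multiset.prod_cons, cycleProdErase]

theorem cycleProd_eq_mul_erase (a : ℕ → ℂ) (σ : Perm (Fin n)) (x : Fin n) :
    cycleProd a σ = a (minimalPeriod σ x) * cycleProdErase a σ (minimalPeriod σ x) := by
  rw [cycleProd, ← Multiset.cons_erase (minimalPeriod_mem_parts σ x), Multiset.map_cons,
    Multiset.prod_cons, cycleProdErase]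

open Classical in
theorem sum_sameCycle {M : Type*} [AddCommMonoid M] (σ : Perm (Fin n)) (x : Fin n)
    (g : Fin n → M) :
    ∑ y ∈ Finset.univ.filter (fun y => σ.SameCycle x y ∧ y ≠ x), g y =
      ∑ i ∈ Finset.Ioo 0 (minimalPeriod σ x), g ((σ ^ i) x) := by
  symm
  refine Finset.sum_bij (fun i _ => (σ ^ i) x) ?_ ?_ ?_ ?_
  · intro i hi
    obtain ⟨h0, hi⟩ := Finset.mem_Ioo.1 hi
    simp only [Finset.mem_filter, Finset.mem_univ, true_and]
    refine ⟨⟨i, by simp⟩, fun h => ?_⟩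
    have := pow_inj_of_lt_minimalPeriod (j := 0) hi (by omega) h
    omega
  · intro i hi j hj h
    exact pow_inj_of_lt_minimalPeriod (Finset.mem_Ioo.1 hi).2 (Finset.mem_Ioo.1 hj).2 h
  · intro y hy
    simp only [Finset.mem_filter, Finset.mem_univ, true_and] at hy
    obtain ⟨i, hi, rfl⟩ := sameCycle_exists_pow_lt hy.1
    refine ⟨i, Finset.mem_Ioo.2 ⟨Nat.pos_of_ne_zero fun h0 => hy.2 (by simp [h0]), hi⟩, rfl⟩
  · intros; rfl

/-- Splitting a `(k + 1)`-cycle through `x` off `σ` cuts the cycle of `x` into `k + 1` pieces of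
arbitrary lengths, counted by the coefficients of `A ^ (k + 1)`. -/
theorem sum_cycleProd_geodesicCycles {a : ℕ → ℂ} (ha : a 0 = 0) (k : ℕ) (σ : Perm (Fin n))
    (x : Fin n) :
    ∑ τ ∈ geodesicCycles k σ x, cycleProd a (σ * τ⁻¹) =
      cycleProdErase a σ (minimalPeriod σ x) *
        PowerSeries.coeff (minimalPeriod σ x) (PowerSeries.mk a ^ (k + 1)) := by
  classical
  induction k generalizing σ with
  | zero =>
    rw [geodesicCycles_zero, Finset.sum_singleton, inv_one, mul_one, zero_add, pow_one,
      PowerSeries.coeff_mk, cycleProd_eq_mul_erase a σ x, mul_comm]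
  | succ k ih =>
    rw [sum_geodesicCycles_succ, Finset.sum_congr rfl fun y _ => ih (σ * swap x y),
      sum_sameCycle, pow_succ' _ (k + 1), PowerSeries.coeff_mul, Finset.mul_sum,
      Finset.Nat.sum_antidiagonal_eq_sum_range_succ (fun i j => cycleProdErase a σ
        (minimalPeriod σ x) * (PowerSeries.coeff i (PowerSeries.mk a) *
        PowerSeries.coeff j (PowerSeries.mk a ^ (k + 1))))]
    have hsub : Finset.Ioo 0 (minimalPeriod σ x) ⊆ Finset.range (minimalPeriod σ x).succ := by
      intro i hi
      have := Finset.mem_Ioo.1 hi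
      exact Finset.mem_range.2 (by omega)
    rw [← Finset.sum_subset hsub]
    · refine Finset.sum_congr rfl fun i hi => ?_
      obtain ⟨h0, hi⟩ := Finset.mem_Ioo.1 hi
      rw [minimalPeriod_mul_swap_left h0 hi, cycleProdErase_mul_swap a h0 hi, PowerSeries.coeff_mk]
      ring
    · intro i hi hi'
      have h1 := Finset.mem_range.1 hi
      rw [Finset.mem_Ioo] at hi'
      rcases Nat.eq_zero_or_pos i with rfl | h0
      · simp [ha]
      · rw [show minimalPeriod σ x - i = 0 by omega]
        simp [ha]

theorem sum_minimalPeriod (σ : Perm (Fin n)) (g : ℕ → ℂ) :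
    ∑ x, g (minimalPeriod σ x) = (σ.partition.parts.map fun p => p * g p).sum := by
  classical
  rw [Finset.sum_multiset_map_count,
    ← Finset.sum_fiberwise_of_maps_to (s := Finset.univ) (g := fun x => minimalPeriod σ x)
      (t := σ.partition.parts.toFinset)
      fun x _ => Multiset.mem_toFinset.2 (minimalPeriod_mem_parts σ x)]
  refine Finset.sum_congr rfl fun p _ => ?_
  rw [Finset.sum_congr rfl (g := fun _ => g p) fun x hx => by rw [(Finset.mem_filter.1 hx).2],
    Finset.sum_const, ← mul_count_parts, nsmul_eq_mul, nsmul_eq_mul]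
  push_cast
  ring

open Classical in
/-- The infinitesimal generator: the matrix entry at `(π, σ)` is `ℓ_k` if `π ≼ σ` and `π⁻¹ σ` is
a cycle of length `k ≥ 2`, and zero otherwise. -/
noncomputable def cycleMatrix (n : ℕ) (ℓ : ℕ → ℂ) :
    Matrix (Perm (Fin n)) (Perm (Fin n)) ℂ :=
  fun π σ => if PermLE π σ ∧ (π⁻¹ * σ).IsCycle then ℓ (permLength (π⁻¹ * σ) + 1) else 0

open Classical in
/-- Each cycle is counted once for every point `x` of its support, which the factor `1 / (k + 2)`
compensates. -/
theorem sum_cycles_eq {σ : Perm (Fin n)} (g : Perm (Fin n) → ℂ) (ℓ : ℕ → ℂ) :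
    ∑ τ ∈ Finset.univ.filter (fun τ : Perm (Fin n) => τ.IsCycle ∧
      permLength (σ * τ⁻¹) + permLength τ = permLength σ), g τ * ℓ (permLength τ + 1) =
    ∑ x, ∑ k ∈ Finset.range n, ℓ (k + 2) / (k + 2) * ∑ τ ∈ geodesicCycles (k + 1) σ x, g τ := by
  have h1 : ∀ x, ∑ k ∈ Finset.range n, ℓ (k + 2) / (k + 2) *
      ∑ τ ∈ geodesicCycles (k + 1) σ x, g τ =
      ∑ τ ∈ Finset.univ.filter (fun τ : Perm (Fin n) => τ.IsCycle ∧
        permLength (σ * τ⁻¹) + permLength τ = permLength σ),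
        if τ x ≠ x then g τ * ℓ (permLength τ + 1) / (permLength τ + 1) else 0 := by
    intro x
    rw [← Finset.sum_filter, ← Finset.sum_fiberwise_of_maps_to (g := fun τ => permLength τ - 1)
      (t := Finset.range n)]
    · refine Finset.sum_congr rfl fun k _ => ?_
      rw [Finset.mul_sum]
      refine Finset.sum_congr ?_ fun τ hτ => ?_
      · ext τ
        simp only [mem_geodesicCycles, IsCycleThrough, Finset.mem_filter, Finset.mem_univ,
          true_and]
        constructor
        · rintro ⟨rfl | ⟨h1, h2⟩, h3, h4⟩
          · rw [permLength_one] at h3; omega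
          · exact ⟨⟨⟨h1, h4⟩, h2⟩, by omega⟩
        · rintro ⟨⟨⟨h1, h4⟩, h2⟩, h3⟩
          refine ⟨Or.inr ⟨h1, h2⟩, ?_, h4⟩
          have := isCycle_permLength h1
          have := h1.two_le_card_support
          omega
      · simp only [Finset.mem_filter, Finset.mem_univ, true_and] at hτ
        have h1 := isCycle_permLength hτ.1.1.1
        have h2 := hτ.1.1.1.two_le_card_support
        have h3 : permLength τ = k + 1 := by omega
        rw [h3]
        push_cast
        ring
    · intro τ hτ
      simp only [Finset.mem_filter, Finset.mem_univ, true_and] at hτ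
      have h1 := isCycle_permLength hτ.1.1
      have h2 := hτ.1.1.two_le_card_support
      have h3 : τ.support.card ≤ n := by simpa using Finset.card_le_univ τ.support
      exact Finset.mem_range.2 (by omega)
  rw [Finset.sum_congr rfl fun x _ => h1 x, Finset.sum_comm]
  refine Finset.sum_congr rfl fun τ hτ => ?_
  simp only [Finset.mem_filter, Finset.mem_univ, true_and] at hτ
  have h2 : (Finset.univ.filter fun x => τ x ≠ x) = τ.support := by ext x; simp
  rw [← Finset.sum_filter, h2, Finset.sum_const, ← isCycle_permLength hτ.1, nsmul_eq_mul]
  have : (permLength τ + 1 : ℂ) ≠ 0 := Nat.cast_add_one_ne_zero _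
  push_cast
  field_simp

/-- The generator acts on multiplicative functions of permutations as a derivation. -/
theorem sum_cycleProd_mul_cycleMatrix {a : ℕ → ℂ} (ha : a 0 = 0) (ℓ : ℕ → ℂ)
    (σ : Perm (Fin n)) :
    ∑ π, cycleProd a π * cycleMatrix n ℓ π σ =
      (σ.partition.parts.map fun p => cycleProdErase a σ p *
        (p * ∑ k ∈ Finset.range n, ℓ (k + 2) / (k + 2) *
          PowerSeries.coeff p (PowerSeries.mk a ^ (k + 2)))).sum := by
  classical
  have h1 : ∑ π, cycleProd a π * cycleMatrix n ℓ π σ =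
      ∑ τ ∈ Finset.univ.filter (fun τ : Perm (Fin n) => τ.IsCycle ∧
      permLength (σ * τ⁻¹) + permLength τ = permLength σ),
      cycleProd a (σ * τ⁻¹) * ℓ (permLength τ + 1) := by
    rw [Finset.sum_filter]
    refine Fintype.sum_equiv ((Equiv.inv _).trans (Equiv.mulRight σ)) _ _ fun π => ?_
    have h2 : σ * (π⁻¹ * σ)⁻¹ = π := by group
    simp only [cycleMatrix, permLE_iff, Equiv.trans_apply, Equiv.inv_apply,
      Equiv.coe_mulRight, h2, mul_ite, mul_zero]
    refine if_congr and_comm rfl rfl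
  rw [h1, sum_cycles_eq]
  simp only [sum_cycleProd_geodesicCycles ha]
  have h2 := sum_minimalPeriod σ (fun p => cycleProdErase a σ p *
        ∑ k ∈ Finset.range n, ℓ (k + 2) / (k + 2) *
          PowerSeries.coeff p (PowerSeries.mk a ^ (k + 2)))
  simp only [mul_left_comm (Nat.cast _ : ℂ)] at h2
  rw [← h2]
  refine Finset.sum_congr rfl fun x _ => ?_
  rw [Finset.mul_sum]
  refine Finset.sum_congr rfl fun k _ => ?_
  ring

end CycleSums

end FreeMul

/-! ### Lagrange inversion -/

namespace FreeMul

open PowerSeries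

section Lagrange

/-- The formal residue of `w' / w^(j+1)` for `w = X / φ`. -/
theorem coeff_pow_mul_derivative_eq (φ : PowerSeries ℂ) (hφ : constantCoeff φ ≠ 0) (j : ℕ) :
    coeff j (φ ^ (j + 1) * d⁄dX ℂ (X * φ⁻¹)) = if j = 0 then 1 else 0 := by
  have h1 : φ * φ⁻¹ = 1 := PowerSeries.mul_inv_cancel φ hφ
  have h2 : d⁄dX ℂ (X * φ⁻¹) = φ⁻¹ - X * φ⁻¹ ^ 2 * d⁄dX ℂ φ := by
    rw [Derivation.leibniz, derivative_inv', derivative_X]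
    simp only [smul_eq_mul]
    ring
  rcases j with _ | j
  · rw [h2, if_pos rfl, zero_add, pow_one, mul_sub, h1, ← mul_assoc, mul_left_comm]
    simp [mul_assoc]
  · rw [if_neg (Nat.succ_ne_zero j)]
    have h3 : φ ^ (j + 1 + 1) * d⁄dX ℂ (X * φ⁻¹) = φ ^ (j + 1) - X * (φ ^ j * d⁄dX ℂ φ) := by
      rw [h2]
      linear_combination φ ^ (j + 1) * h1 - X * φ ^ j * d⁄dX ℂ φ * (φ * φ⁻¹ + 1) * h1
    have h4 : coeff j (d⁄dX ℂ (φ ^ (j + 1))) = coeff (j + 1) (φ ^ (j + 1)) * (j + 1) :=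
      coeff_derivative _ _
    rw [derivative_pow, Nat.add_sub_cancel, mul_assoc, ← map_natCast (C (R := ℂ)),
      coeff_C_mul] at h4
    rw [h3, map_sub, coeff_succ_X_mul]
    have h5 : ((j + 1 : ℕ) : ℂ) ≠ 0 := Nat.cast_ne_zero.2 (Nat.succ_ne_zero j)
    apply mul_right_cancel₀ h5
    push_cast at h4 ⊢
    linear_combination -h4

/-- **Lagrange inversion**: the coefficients of the powers of the compositional inverse `A` of
`X / φ`. -/
theorem lagrange_inversion {φ A : PowerSeries ℂ} (hφ : constantCoeff φ ≠ 0)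
    (hA : A.subst (X * φ⁻¹) = X) {n k : ℕ} (hk : 1 ≤ k) (hkn : k ≤ n) :
    (n : ℂ) * coeff n (A ^ k) = k * coeff (n - k) (φ ^ n) := by
  have h1 : φ * φ⁻¹ = 1 := PowerSeries.mul_inv_cancel φ hφ
  have hP : HasSubst (X * φ⁻¹) := HasSubst.of_constantCoeff_zero' (by simp)
  have h2 : (A ^ k).subst (X * φ⁻¹) = (X : PowerSeries ℂ) ^ k := by rw [subst_pow hP, hA]
  have h3 : (d⁄dX ℂ (A ^ k)).subst (X * φ⁻¹) * d⁄dX ℂ (X * φ⁻¹) = d⁄dX ℂ (X ^ k) := by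
    rw [← derivative_subst hP, h2]
  -- Compare the coefficients of `X ^ (n - 1)` after multiplication by `φ ^ n`.
  obtain ⟨m, rfl⟩ : ∃ m, n = m + 1 := ⟨n - 1, by omega⟩
  have h4 : coeff m (φ ^ (m + 1) * ((d⁄dX ℂ (A ^ k)).subst (X * φ⁻¹) * d⁄dX ℂ (X * φ⁻¹))) =
      coeff m (d⁄dX ℂ (A ^ k)) := by
    have h5 : ∀ j, coeff m (φ ^ (m + 1) * ((X * φ⁻¹) ^ j * d⁄dX ℂ (X * φ⁻¹))) =
        if j = m then 1 else 0 := by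
      intro j
      rcases lt_or_ge m j with hj | hj
      · rw [if_neg (by omega), show φ ^ (m + 1) * ((X * φ⁻¹) ^ j * d⁄dX ℂ (X * φ⁻¹)) =
          X ^ j * (φ ^ (m + 1) * (φ⁻¹ ^ j * d⁄dX ℂ (X * φ⁻¹))) by ring,
          coeff_X_pow_mul', if_neg (by omega)]
      · obtain ⟨i, rfl⟩ := Nat.exists_eq_add_of_le hj
        have h6 : φ ^ (j + i + 1) * ((X * φ⁻¹) ^ j * d⁄dX ℂ (X * φ⁻¹)) =
            X ^ j * (φ ^ (i + 1) * d⁄dX ℂ (X * φ⁻¹)) := by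
          rw [show φ ^ (j + i + 1) * ((X * φ⁻¹) ^ j * d⁄dX ℂ (X * φ⁻¹)) =
            (φ * φ⁻¹) ^ j * (X ^ j * (φ ^ (i + 1) * d⁄dX ℂ (X * φ⁻¹))) by ring, h1, one_pow,
            one_mul]
        rw [h6, add_comm j i, coeff_X_pow_mul, coeff_pow_mul_derivative_eq φ hφ]
        exact if_congr (by omega) rfl rfl
    set G := d⁄dX ℂ (A ^ k) with hG
    -- only the part of `G` of degree at most `m` matters
    have h7 : G = (trunc (m + 1) G : PowerSeries ℂ) + X ^ (m + 1) * mk fun i => coeff (i + (m + 1)) G := by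
      rw [add_comm, mul_comm]
      exact eq_shift_mul_X_pow_add_trunc (m + 1) G
    have h8 : (X ^ (m + 1) * mk fun i => coeff (i + (m + 1)) G : PowerSeries ℂ).subst (X * φ⁻¹) =
        X ^ (m + 1) * (φ⁻¹ ^ (m + 1) *
          (mk fun i => coeff (i + (m + 1)) G : PowerSeries ℂ).subst (X * φ⁻¹)) := by
      rw [subst_mul hP, subst_pow hP, subst_X hP]; ring
    have h9 : ((trunc (m + 1) G : Polynomial ℂ) : PowerSeries ℂ).subst (X * φ⁻¹) =
        ∑ j ∈ Finset.range (m + 1), C (coeff j G) * (X * φ⁻¹) ^ j := by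
      rw [subst_coe hP, Polynomial.aeval_def, Polynomial.eval₂_eq_sum_range'
        (n := m + 1) _ (natDegree_trunc_lt G m)]
      refine Finset.sum_congr rfl fun j hj => ?_
      rw [coeff_trunc, if_pos (Finset.mem_range.1 hj)]
      rfl
    rw [h7, subst_add hP, h8, h9]
    rw [add_mul, mul_add, map_add, Finset.sum_mul, Finset.mul_sum, map_sum]
    rw [Finset.sum_congr rfl (g := fun j => coeff j G * if j = m then 1 else 0) fun j _ => by
      rw [← h5 j, ← coeff_C_mul]; congr 1; ring]
    rw [show φ ^ (m + 1) * (X ^ (m + 1) * (φ⁻¹ ^ (m + 1) *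
          (mk fun i => coeff (i + (m + 1)) G : PowerSeries ℂ).subst (X * φ⁻¹)) *
          d⁄dX ℂ (X * φ⁻¹)) = X ^ (m + 1) * (φ ^ (m + 1) * (φ⁻¹ ^ (m + 1) *
          (mk fun i => coeff (i + (m + 1)) G : PowerSeries ℂ).subst (X * φ⁻¹)) *
          d⁄dX ℂ (X * φ⁻¹)) by ring, coeff_X_pow_mul', if_neg (by omega), ← h7]
    simp
  rw [h3, coeff_derivative, derivative_pow, derivative_X, mul_one, mul_left_comm,
    ← map_natCast (C (R := ℂ)), coeff_C_mul, mul_comm (φ ^ (m + 1)), coeff_X_pow_mul',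
    if_pos (by omega)] at h4
  rw [show m + 1 - k = m - (k - 1) by omega, h4]
  push_cast
  ring

end Lagrange

end FreeMul

/-! ### The exponential flow of a power series -/

namespace FreeMul

open PowerSeries

section Flow

theorem coeff_subst_eq_sum {Λ : PowerSeries ℂ} (hΛ : constantCoeff Λ = 0) (f : PowerSeries ℂ)
    {m N : ℕ} (hm : m < N) :
    coeff m (f.subst Λ) = ∑ j ∈ Finset.range N, coeff j f * coeff m (Λ ^ j) := by
  rw [coeff_subst' (HasSubst.of_constantCoeff_zero' hΛ), finsum_eq_sum_of_support_subset]
  · rfl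
  · intro j hj
    rw [Finset.coe_range, Set.mem_Iio]
    by_contra hjN
    refine hj ?_
    have h1 : X ^ j ∣ Λ ^ j := pow_dvd_pow_of_dvd (X_dvd_iff.2 hΛ) j
    simp only
    rw [X_pow_dvd_iff.1 h1 m (by omega), smul_zero]

/-- The power series `exp (t Λ)`. -/
noncomputable def expFlow (Λ : PowerSeries ℂ) (t : ℂ) : PowerSeries ℂ :=
  (rescale t (exp ℂ)).subst Λ

variable {Λ : PowerSeries ℂ}

theorem expFlow_add (hΛ : constantCoeff Λ = 0) (s t : ℂ) :
    expFlow Λ (s + t) = expFlow Λ s * expFlow Λ t := by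
  rw [expFlow, ← exp_mul_exp_eq_exp_add, subst_mul (HasSubst.of_constantCoeff_zero' hΛ)]
  rfl

theorem expFlow_zero (hΛ : constantCoeff Λ = 0) : expFlow Λ 0 = 1 := by
  rw [expFlow]
  simp only [rescale_zero, RingHom.comp_apply, constantCoeff_exp, map_one]
  rw [← coe_substAlgHom (HasSubst.of_constantCoeff_zero' hΛ), map_one]

theorem constantCoeff_expFlow (hΛ : constantCoeff Λ = 0) (t : ℂ) :
    constantCoeff (expFlow Λ t) = 1 := by
  rw [← coeff_zero_eq_constantCoeff_apply, expFlow, coeff_subst_eq_sum hΛ _ zero_lt_one]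
  simp

theorem expFlow_pow (hΛ : constantCoeff Λ = 0) (t : ℂ) (p : ℕ) :
    expFlow Λ t ^ p = expFlow Λ (p * t) := by
  induction p with
  | zero => simp [expFlow_zero hΛ]
  | succ p ih => rw [pow_succ, ih, ← expFlow_add hΛ]; push_cast; ring_nf

theorem hasDerivAt_coeff_expFlow (hΛ : constantCoeff Λ = 0) (m : ℕ) (t : ℂ) :
    HasDerivAt (fun t => coeff m (expFlow Λ t)) (coeff m (Λ * expFlow Λ t)) t := by
  have h1 : ∀ t, coeff m (expFlow Λ t) =
      ∑ j ∈ Finset.range (m + 2), t ^ j * ((1 / j.factorial : ℚ) : ℂ) * coeff m (Λ ^ j) := by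
    intro t
    rw [expFlow, coeff_subst_eq_sum hΛ _ (show m < m + 2 by omega)]
    simp [coeff_rescale]
  have h2 : coeff m (Λ * expFlow Λ t) =
      ∑ j ∈ Finset.range (m + 2), (j * t ^ (j - 1)) * ((1 / j.factorial : ℚ) : ℂ) *
        coeff m (Λ ^ j) := by
    have h3 : Λ * expFlow Λ t = (X * rescale t (exp ℂ)).subst Λ := by
      rw [subst_mul (HasSubst.of_constantCoeff_zero' hΛ),
        subst_X (HasSubst.of_constantCoeff_zero' hΛ)]
      rfl
    rw [h3, coeff_subst_eq_sum hΛ _ (show m < m + 2 by omega)]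
    refine Finset.sum_congr rfl fun j _ => ?_
    rcases j with _ | j
    · simp
    · rw [coeff_succ_X_mul, coeff_rescale, coeff_exp, Nat.factorial_succ]
      have : (j.factorial : ℂ) ≠ 0 := Nat.cast_ne_zero.2 (Nat.factorial_ne_zero j)
      have h5 : ((j : ℂ) + 1) ≠ 0 := Nat.cast_add_one_ne_zero j
      simp only [eq_ratCast]
      push_cast
      field_simp
  simp only [h1]
  rw [h2]
  refine HasDerivAt.fun_sum fun j _ => ?_
  exact ((hasDerivAt_pow j t).mul_const _).mul_const _

/-- If `φ_t = φ exp (t Λ)`, these are the coefficients of the compositional inverse of `X / φ_t`,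
in the form given by Lagrange inversion. At `p = 0` the value is `0`, because `0⁻¹ = 0`. -/
noncomputable def flowCoeff (φ Λ : PowerSeries ℂ) (t : ℂ) (p : ℕ) : ℂ :=
  (p : ℂ)⁻¹ * coeff (p - 1) ((φ * expFlow Λ t) ^ p)

theorem flowCoeff_zero (φ Λ : PowerSeries ℂ) (t : ℂ) : flowCoeff φ Λ t 0 = 0 := by
  simp [flowCoeff]

/-- Lagrange inversion for the powers of the series with coefficients `flowCoeff`. -/
theorem natCast_mul_coeff_mk_flowCoeff {φ : PowerSeries ℂ} (hφ : constantCoeff φ = 1)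
    (hΛ : constantCoeff Λ = 0) (t : ℂ) {p k : ℕ} (hk : 1 ≤ k) (hkp : k ≤ p) :
    (p : ℂ) * coeff p (mk (flowCoeff φ Λ t) ^ k) =
      k * coeff (p - k) ((φ * expFlow Λ t) ^ p) := by
  set ψ := φ * expFlow Λ t with hψ
  have h1 : constantCoeff ψ = 1 := by rw [hψ, map_mul, hφ, constantCoeff_expFlow hΛ, one_mul]
  have hu : IsUnit (coeff 1 (X * ψ⁻¹)) := by
    rw [show (1 : ℕ) = 0 + 1 from rfl, coeff_succ_X_mul, coeff_zero_eq_constantCoeff_apply,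
      constantCoeff_inv, h1, inv_one]
    exact isUnit_one
  have h2 : (substInvOfIsUnit (X * ψ⁻¹) hu).subst (X * ψ⁻¹) = X :=
    subst_substInvOfIsUnit_left _ (by simp) hu
  have h3 : mk (flowCoeff φ Λ t) = substInvOfIsUnit (X * ψ⁻¹) hu := by
    ext q
    rcases Nat.eq_zero_or_pos q with rfl | hq
    · rw [coeff_mk, flowCoeff_zero, coeff_zero_eq_constantCoeff_apply,
        constantCoeff_substInvOfIsUnit]
    · have h4 := lagrange_inversion (by rw [h1]; exact one_ne_zero) h2 le_rfl hq
      rw [pow_one, Nat.cast_one, one_mul] at h4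
      rw [coeff_mk, flowCoeff, ← hψ, ← h4, inv_mul_cancel_left₀]
      exact Nat.cast_ne_zero.2 hq.ne'
  rw [h3]
  exact lagrange_inversion (by rw [h1]; exact one_ne_zero) h2 hk hkp

/-- The flow equation satisfied by the coefficients of the compositional inverse. -/
theorem hasDerivAt_flowCoeff {φ : PowerSeries ℂ} (hφ : constantCoeff φ = 1) (ℓ : ℕ → ℂ) (t : ℂ)
    {p n : ℕ} (hp : p ≤ n) :
    HasDerivAt (fun t => flowCoeff φ (X * mk fun k => ℓ (k + 2)) t p)
      (p * ∑ k ∈ Finset.range n, ℓ (k + 2) / (k + 2) *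
          coeff p (mk (flowCoeff φ (X * mk fun k => ℓ (k + 2)) t) ^ (k + 2))) t := by
  set Λ : PowerSeries ℂ := X * mk fun k => ℓ (k + 2) with hΛ'
  have hΛ : constantCoeff Λ = 0 := by simp [hΛ']
  rcases Nat.eq_zero_or_pos p with rfl | hp0
  · simpa [flowCoeff_zero] using hasDerivAt_const t (0 : ℂ)
  have hp' : (p : ℂ) ≠ 0 := Nat.cast_ne_zero.2 hp0.ne'
  have h1 : HasDerivAt (fun t => coeff (p - 1) ((φ * expFlow Λ t) ^ p))
      (p * coeff (p - 1) (Λ * (φ * expFlow Λ t) ^ p)) t := by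
    have h2 : ∀ t, (φ * expFlow Λ t) ^ p = φ ^ p * expFlow Λ (p * t) := fun t => by
      rw [mul_pow, expFlow_pow hΛ]
    rw [h2, mul_left_comm, coeff_mul, Finset.mul_sum]
    simp only [h2, coeff_mul _ (φ ^ p)]
    refine HasDerivAt.fun_sum fun q _ => ?_
    have h3 := (hasDerivAt_coeff_expFlow hΛ q.2 (p * t)).comp t ((hasDerivAt_id t).const_mul (p : ℂ))
    refine (h3.const_mul (coeff q.1 (φ ^ p))).congr_deriv ?_
    ring
  refine (h1.const_mul ((p : ℂ)⁻¹)).congr_deriv ?_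
  rw [inv_mul_cancel_left₀ hp']
  obtain ⟨m, rfl⟩ : ∃ m, p = m + 1 := ⟨p - 1, by omega⟩
  set ψ := φ * expFlow Λ t with hψ
  -- Both sides are the coefficient of `Λ * ψ ^ p`, by Lagrange inversion.
  have hterm : ∀ k, (↑(m + 1) : ℂ) * (ℓ (k + 2) / (k + 2) *
      coeff (m + 1) (mk (flowCoeff φ Λ t) ^ (k + 2))) =
      if k < m then ℓ (k + 2) * coeff (m - 1 - k) (ψ ^ (m + 1)) else 0 := by
    intro k
    have hk : (k + 2 : ℂ) ≠ 0 := by exact_mod_cast (Nat.succ_ne_zero (k + 1))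
    split_ifs with hkm
    · have := natCast_mul_coeff_mk_flowCoeff (k := k + 2) hφ hΛ t (by omega)
        (show k + 2 ≤ m + 1 by omega)
      rw [← hψ, show m + 1 - (k + 2) = m - 1 - k by omega] at this
      rw [mul_left_comm, this]
      push_cast
      field_simp
    · have h4 : X ^ (k + 2) ∣ mk (flowCoeff φ Λ t) ^ (k + 2) := by
        refine pow_dvd_pow_of_dvd (X_dvd_iff.2 ?_) _
        rw [← coeff_zero_eq_constantCoeff_apply, coeff_mk, flowCoeff_zero]
      rw [X_pow_dvd_iff.1 h4 _ (by omega), mul_zero, mul_zero]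
  rw [Finset.mul_sum, Finset.sum_congr rfl fun k _ => hterm k, Nat.add_sub_cancel, hΛ', mul_assoc]
  rcases m with _ | m
  · rw [coeff_zero_X_mul]
    simp
  · rw [coeff_succ_X_mul, coeff_mul,
      Finset.Nat.sum_antidiagonal_eq_sum_range_succ (fun i j => coeff i (mk fun k => ℓ (k + 2)) *
        coeff j (ψ ^ (m + 1 + 1)))]
    rw [← Finset.sum_filter, show (Finset.range n).filter (fun k => k < m + 1) =
      Finset.range m.succ by ext k; simp only [Finset.mem_filter, Finset.mem_range]; omega]
    simp [coeff_mk]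

/-- The flow equation `v' = v L` for the multiplicative function `v` built on `flowCoeff`. -/
theorem hasDerivAt_cycleProd_flowCoeff {n : ℕ} {φ : PowerSeries ℂ} (hφ : constantCoeff φ = 1)
    (ℓ : ℕ → ℂ) (σ : Equiv.Perm (Fin n)) (t : ℂ) :
    HasDerivAt (fun t => cycleProd (flowCoeff φ (X * mk fun k => ℓ (k + 2)) t) σ)
      (∑ π, cycleProd (flowCoeff φ (X * mk fun k => ℓ (k + 2)) t) π * cycleMatrix n ℓ π σ) t := by
  classical
  rw [sum_cycleProd_mul_cycleMatrix (flowCoeff_zero _ _ _)]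
  unfold cycleProd cycleProdErase
  have h := HasFDerivAt.multiset_prod (u := σ.partition.parts)
    (g := fun p t => flowCoeff φ (X * mk fun k => ℓ (k + 2)) t p) (x := t)
    fun p hp => (hasDerivAt_flowCoeff hφ ℓ t (n := n) ?_).hasFDerivAt
  · refine h.hasDerivAt.congr_deriv ?_
    have hsum : ∀ (s : Multiset ℕ) (f : ℕ → ℂ →L[ℂ] ℂ),
        (s.map f).sum 1 = (s.map fun p => f p 1).sum := by
      intro s f
      induction s using Multiset.induction with
      | empty => simp
      | cons p s ih => simp [ih]
    rw [hsum]
    simp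
  · have := Multiset.single_le_sum (fun x _ => Nat.zero_le x) p hp
    rw [σ.partition.parts_sum] at this
    simpa using this

end Flow

end FreeMul

/-! ### Graded matrices over the symmetric group -/

namespace FreeMul

open Matrix

section LinearFlow

variable {n : ℕ}

theorem permLength_le (σ : Equiv.Perm (Fin n)) : permLength σ ≤ n := Nat.sub_le _ _

theorem permLength_lt_of_cycleMatrix_ne_zero {ℓ : ℕ → ℂ} {π σ : Equiv.Perm (Fin n)}
    (h : cycleMatrix n ℓ π σ ≠ 0) : permLength π < permLength σ := by
  unfold cycleMatrix at h
  split_ifs at h with h1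
  swap
  · exact absurd rfl h
  have h2 := permLE_iff.1 h1.1
  have h3 := isCycle_permLength h1.2
  have h4 := h1.2.two_le_card_support
  omega

/-- The generator is nilpotent, since a nonzero entry at `(π, σ)` forces the length of `σ` to be
greater than that of `π`. -/
theorem cycleMatrix_pow_eq_zero (ℓ : ℕ → ℂ) : cycleMatrix n ℓ ^ (n + 1) = 0 := by
  have key : ∀ l (π σ : Equiv.Perm (Fin n)), (cycleMatrix n ℓ ^ l) π σ ≠ 0 →
      permLength π + l ≤ permLength σ := by
    intro l
    induction l with
    | zero =>
      intro π σ h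
      rw [pow_zero, Matrix.one_apply] at h
      split_ifs at h with h1
      · rw [h1]; rfl
      · exact absurd rfl h
    | succ l ih =>
      intro π σ h
      rw [pow_succ, Matrix.mul_apply] at h
      obtain ⟨ρ, -, hρ⟩ := Finset.exists_ne_zero_of_sum_ne_zero h
      have h1 := ih π ρ (left_ne_zero_of_mul hρ)
      have h2 := permLength_lt_of_cycleMatrix_ne_zero (right_ne_zero_of_mul hρ)
      omega
  ext π σ
  by_contra h
  have h1 := key _ π σ h
  have h2 := permLength_le σ
  omega

/-- The linear differential equation `v' = v L` with `L` the (nilpotent) generator is solved by the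
exponential. -/
theorem linearFlow_eq {ℓ : ℕ → ℂ} {v : ℂ → Equiv.Perm (Fin n) → ℂ}
    (hv : ∀ t σ, HasDerivAt (fun t => v t σ) (∑ π, v t π * cycleMatrix n ℓ π σ) t) (t : ℂ)
    (σ : Equiv.Perm (Fin n)) :
    v t σ = ∑ l ∈ Finset.range (n + 1),
      t ^ l * ((1 / l.factorial : ℂ) * (v 0 ᵥ* cycleMatrix n ℓ ^ l) σ) := by
  set u : ℂ → Equiv.Perm (Fin n) → ℂ := fun t σ => ∑ l ∈ Finset.range (n + 1),
      t ^ l * ((1 / l.factorial : ℂ) * (v 0 ᵥ* cycleMatrix n ℓ ^ l) σ) with hu'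
  have hu : ∀ t σ, HasDerivAt (fun t => u t σ) (∑ π, u t π * cycleMatrix n ℓ π σ) t := by
    intro t σ
    have h1 : HasDerivAt (fun t => u t σ) (∑ l ∈ Finset.range (n + 1),
        (l * t ^ (l - 1)) * ((1 / l.factorial : ℂ) * (v 0 ᵥ* cycleMatrix n ℓ ^ l) σ)) t :=
      HasDerivAt.fun_sum fun l _ => (hasDerivAt_pow l t).mul_const _
    refine h1.congr_deriv ?_
    simp only [hu', Finset.sum_mul]
    rw [Finset.sum_comm, Finset.sum_range_succ' _ n, Finset.sum_range_succ _ n]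
    have h2 : ∀ l, ∑ π, t ^ l * ((1 / l.factorial : ℂ) * (v 0 ᵥ* cycleMatrix n ℓ ^ l) π) *
        cycleMatrix n ℓ π σ =
        t ^ l * ((1 / l.factorial : ℂ) * (v 0 ᵥ* cycleMatrix n ℓ ^ (l + 1)) σ) := by
      intro l
      rw [pow_succ, ← Matrix.vecMul_vecMul]
      conv_rhs => rw [Matrix.vecMul, dotProduct]
      simp only [Finset.mul_sum, mul_assoc]
    simp only [h2, cycleMatrix_pow_eq_zero, Matrix.vecMul_zero, Pi.zero_apply, mul_zero, add_zero,
      Nat.cast_zero, zero_mul]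
    refine Finset.sum_congr rfl fun l _ => ?_
    rw [Nat.factorial_succ, Nat.add_sub_cancel]
    have h3 : (l.factorial : ℂ) ≠ 0 := Nat.cast_ne_zero.2 (Nat.factorial_ne_zero l)
    have h4 : (l + 1 : ℂ) ≠ 0 := Nat.cast_add_one_ne_zero l
    push_cast
    field_simp
  have hu0 : ∀ σ, u 0 σ = v 0 σ := by
    intro σ
    simp only [hu', Finset.sum_range_succ' _ n]
    simp
  -- the system is triangular for the length
  have key : ∀ k σ, permLength σ = k → ∀ t, v t σ - u t σ = 0 := by
    intro k
    induction k using Nat.strong_induction_on with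
    | _ k ih =>
      intro σ hσ t
      have h1 : ∀ t, HasDerivAt (fun t => v t σ - u t σ) 0 t := by
        intro t
        refine ((hv t σ).sub (hu t σ)).congr_deriv ?_
        rw [← Finset.sum_sub_distrib]
        refine Finset.sum_eq_zero fun π _ => ?_
        rw [← sub_mul]
        by_cases hL : cycleMatrix n ℓ π σ = 0
        · rw [hL, mul_zero]
        · rw [ih (permLength π) (hσ ▸ permLength_lt_of_cycleMatrix_ne_zero hL) π rfl t, zero_mul]
      have h2 := is_const_of_deriv_eq_zero (f := fun t => v t σ - u t σ)
        (fun t => (h1 t).differentiableAt) (fun t => (h1 t).deriv) t 0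
      simp only [hu0, sub_self] at h2
      exact h2
  exact sub_eq_zero.1 (key _ σ rfl t)

end LinearFlow

section Graded

variable {n : ℕ}

open Classical in
/-- The matrix with entry `x (π⁻¹ σ)` at `(π, σ)` if `π ≼ σ`, and zero otherwise. -/
noncomputable def gradedMatrix (x : Equiv.Perm (Fin n) → ℂ) :
    Matrix (Equiv.Perm (Fin n)) (Equiv.Perm (Fin n)) ℂ :=
  fun π σ => if PermLE π σ then x (π⁻¹ * σ) else 0

theorem gradedMatrix_of_le (x : Equiv.Perm (Fin n) → ℂ) {π σ : Equiv.Perm (Fin n)}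
    (h : PermLE π σ) : gradedMatrix x π σ = x (π⁻¹ * σ) := if_pos h

theorem gradedMatrix_of_not_le (x : Equiv.Perm (Fin n) → ℂ) {π σ : Equiv.Perm (Fin n)}
    (h : ¬ PermLE π σ) : gradedMatrix x π σ = 0 := if_neg h

theorem gradedMatrix_one_row (x : Equiv.Perm (Fin n) → ℂ) (σ : Equiv.Perm (Fin n)) :
    gradedMatrix x 1 σ = x σ := by
  rw [gradedMatrix_of_le x (one_permLE σ), inv_one, one_mul]

/-- Matrices that depend on `π⁻¹ * σ` along `PermLE π σ` are closed under products: translation by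
`π⁻¹` carries the interval from `π` to `σ` onto the one from `1` to `π⁻¹ * σ`. -/
theorem gradedMatrix_mul (x y : Equiv.Perm (Fin n) → ℂ) :
    gradedMatrix x * gradedMatrix y = gradedMatrix ((gradedMatrix x * gradedMatrix y) 1) := by
  ext π σ
  by_cases hπσ : PermLE π σ
  · rw [gradedMatrix_of_le _ hπσ, Matrix.mul_apply, Matrix.mul_apply]
    refine Fintype.sum_equiv (Equiv.mulLeft π⁻¹) _ _ fun ρ => ?_
    have h := permLE_trans_iff (π := π) (ρ := ρ) (σ := σ)
    rw [Equiv.coe_mulLeft, gradedMatrix_one_row]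
    simp only [hπσ, true_and] at h
    by_cases h1 : PermLE (π⁻¹ * ρ) (π⁻¹ * σ)
    · rw [gradedMatrix_of_le _ (h.2 h1).1, gradedMatrix_of_le _ (h.2 h1).2,
        gradedMatrix_of_le _ h1, show (π⁻¹ * ρ)⁻¹ * (π⁻¹ * σ) = ρ⁻¹ * σ by group]
    · rw [gradedMatrix_of_not_le _ h1, mul_zero]
      by_cases h2 : PermLE π ρ
      · rw [gradedMatrix_of_not_le y fun h3 => h1 (h.1 ⟨h2, h3⟩), mul_zero]
      · rw [gradedMatrix_of_not_le x h2, zero_mul]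
  · rw [gradedMatrix_of_not_le _ hπσ, Matrix.mul_apply]
    refine Finset.sum_eq_zero fun ρ _ => ?_
    by_cases h2 : PermLE π ρ
    · rw [gradedMatrix_of_not_le y fun h3 => hπσ (permLE_trans_iff.1 ⟨h2, h3⟩).1, mul_zero]
    · rw [gradedMatrix_of_not_le x h2, zero_mul]

theorem one_eq_gradedMatrix : (1 : Matrix (Equiv.Perm (Fin n)) (Equiv.Perm (Fin n)) ℂ) =
    gradedMatrix ((1 : Matrix (Equiv.Perm (Fin n)) (Equiv.Perm (Fin n)) ℂ) 1) := by
  ext π σ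
  by_cases h : PermLE π σ
  · rw [gradedMatrix_of_le _ h, Matrix.one_apply, Matrix.one_apply]
    exact if_congr (by rw [eq_comm (a := (1 : Equiv.Perm (Fin n))), inv_mul_eq_one]) rfl rfl
  · rw [gradedMatrix_of_not_le _ h, Matrix.one_apply_ne]
    rintro rfl
    exact h (permLE_refl π)

theorem gradedMatrix_pow (x : Equiv.Perm (Fin n) → ℂ) (l : ℕ) :
    gradedMatrix x ^ l = gradedMatrix ((gradedMatrix x ^ l) 1) := by
  induction l with
  | zero => rw [pow_zero]; exact one_eq_gradedMatrix
  | succ l ih => rw [pow_succ, ih, ← gradedMatrix_mul]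

theorem cycleMatrix_eq_gradedMatrix (ℓ : ℕ → ℂ) :
    cycleMatrix n ℓ = gradedMatrix (cycleMatrix n ℓ 1) := by
  ext π σ
  by_cases h : PermLE π σ
  · rw [gradedMatrix_of_le _ h]
    classical
    exact if_congr (by rw [inv_one, one_mul]; simp [one_permLE, h])
      (by rw [inv_one, one_mul]) rfl
  · rw [gradedMatrix_of_not_le _ h, cycleMatrix, if_neg fun h1 => h h1.1]

end Graded

section LogExp

open Polynomial

/-- `log (1 + (e^X - 1)) = X` as formal power series; both sides have derivative `1`. -/
theorem log_subst_exp_sub_one :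
    (PowerSeries.log ℂ).subst (PowerSeries.exp ℂ - 1) = PowerSeries.X := by
  have hs : PowerSeries.HasSubst (PowerSeries.exp ℂ - 1) := PowerSeries.HasSubst.exp_sub_one
  refine PowerSeries.derivative.ext ?_ ?_
  · rw [PowerSeries.derivative_subst hs, PowerSeries.deriv_log, PowerSeries.derivative_X, map_sub,
      PowerSeries.derivative_exp]
    have h1 : (PowerSeries.mk fun n => algebraMap ℚ ℂ ((-1 : ℚ) ^ n)) * (1 + PowerSeries.X) = 1 := by
      ext m
      rw [mul_add, mul_one, map_add]
      rcases m with _ | m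
      · simp
      · rw [PowerSeries.coeff_succ_mul_X]
        simp [pow_succ, PowerSeries.coeff_one]
    have h2 := congrArg (fun f : PowerSeries ℂ => f.subst (PowerSeries.exp ℂ - 1)) h1
    simp only [PowerSeries.subst_mul hs, PowerSeries.subst_add hs, PowerSeries.subst_X hs] at h2
    have h3 : (1 : PowerSeries ℂ).subst (PowerSeries.exp ℂ - 1) = (1 : PowerSeries ℂ) := by
      rw [← PowerSeries.coe_substAlgHom hs, map_one]
    rw [h3] at h2
    have h4 : PowerSeries.derivative ℂ (1 : PowerSeries ℂ) = 0 := PowerSeries.derivative_one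
    rw [h4, sub_zero]
    rw [add_sub_cancel] at h2
    exact h2
  · rw [PowerSeries.constantCoeff_X]
    refine PowerSeries.constantCoeff_subst_eq_zero ?_ _ (by simp)
    change PowerSeries.constantCoeff (PowerSeries.exp ℂ - 1) = 0
    simp

/-- The logarithm of the exponential of a nilpotent element. -/
theorem log_exp_of_pow_eq_zero {A : Type*} [Ring A] [Algebra ℂ A] {a : A} {N : ℕ}
    (ha : a ^ (N + 2) = 0) :
    ∑ l ∈ Finset.range (N + 2), ((-1) ^ (1 + l) / l : ℂ) •
      (∑ j ∈ Finset.range (N + 2), (1 / j.factorial : ℂ) • a ^ j - 1) ^ l = a := by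
  set E : ℂ[X] := PowerSeries.trunc (N + 2) (PowerSeries.exp ℂ) with hE
  set Q : ℂ[X] := ∑ l ∈ Finset.range (N + 2), ((-1) ^ (1 + l) / l : ℂ) • (E - 1) ^ l with hQ
  have h1 : aeval a E = ∑ j ∈ Finset.range (N + 2), (1 / j.factorial : ℂ) • a ^ j := by
    rw [aeval_eq_sum_range' (n := N + 2) (PowerSeries.natDegree_trunc_lt _ _)]
    refine Finset.sum_congr rfl fun j hj => ?_
    rw [PowerSeries.coeff_trunc, if_pos (Finset.mem_range.1 hj)]
    simp
  have h2 : (X : ℂ[X]) ^ (N + 2) ∣ Q - X := by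
    rw [X_pow_dvd_iff]
    intro m hm
    have h3 : ((E - 1 : ℂ[X]) : PowerSeries ℂ) =
        (PowerSeries.trunc (N + 2) (PowerSeries.exp ℂ - 1) : ℂ[X]) := by
      rw [PowerSeries.trunc_sub, PowerSeries.trunc_one]
    have h4 : ∀ l, (((E - 1) ^ l : ℂ[X])).coeff m =
        PowerSeries.coeff m ((PowerSeries.exp ℂ - 1) ^ l) := by
      intro l
      rw [← Polynomial.coeff_coe, Polynomial.coe_pow, h3,
        ← PowerSeries.coeff_coe_trunc_of_lt hm, PowerSeries.trunc_trunc_pow,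
        PowerSeries.coeff_coe_trunc_of_lt hm]
    have h5 := congrArg (PowerSeries.coeff m) log_subst_exp_sub_one
    rw [coeff_subst_eq_sum (by simp) _ hm] at h5
    rw [coeff_sub, sub_eq_zero, hQ, finsetSum_coeff, ← Polynomial.coeff_coe, Polynomial.coe_X,
      ← h5]
    refine Finset.sum_congr rfl fun l _ => ?_
    rw [coeff_smul, h4, smul_eq_mul, PowerSeries.coeff_log]
    congr 1
    split_ifs with hl
    · simp [hl]
    · simp [add_comm]
  obtain ⟨R, hR⟩ := h2
  have h6 := congrArg (aeval a) hR
  rw [map_sub, aeval_X, map_mul, map_pow, aeval_X, ha, zero_mul, sub_eq_zero] at h6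
  rw [← h1]
  refine Eq.trans ?_ h6
  rw [hQ]
  simp

end LogExp

end FreeMul

/-! ### Chain sums as powers of matrices -/

namespace FreeMul

open Matrix

section Chains

theorem sum_paths_eq {α : Type*} [Fintype α] [DecidableEq α] (W : Matrix α α ℂ) (h k : α → ℂ)
    (l : ℕ) :
    ∑ p : Fin (l + 1) → α, h (p 0) * (∏ i : Fin l, W (p i.castSucc) (p i.succ)) * k (p (Fin.last l)) =
      (h ᵥ* W ^ l) ⬝ᵥ k := by
  induction l generalizing k with
  | zero =>
    rw [pow_zero, Matrix.vecMul_one, dotProduct]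
    refine Fintype.sum_equiv (Equiv.funUnique (Fin 1) α) _ _ fun p => ?_
    simp [Equiv.funUnique]
  | succ l ih =>
    rw [← (Fin.snocEquiv fun _ : Fin (l + 2) => α).sum_comp, Fintype.sum_prod_type_right]
    have h1 : ∀ (q : Fin (l + 1) → α), ∑ z : α,
        (h ((Fin.snocEquiv fun _ : Fin (l + 2) => α) (z, q) 0) *
          (∏ i : Fin (l + 1), W ((Fin.snocEquiv fun _ : Fin (l + 2) => α) (z, q) i.castSucc)
            ((Fin.snocEquiv fun _ : Fin (l + 2) => α) (z, q) i.succ)) *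
          k ((Fin.snocEquiv fun _ : Fin (l + 2) => α) (z, q) (Fin.last (l + 1)))) =
        h (q 0) * (∏ i : Fin l, W (q i.castSucc) (q i.succ)) * (W *ᵥ k) (q (Fin.last l)) := by
      intro q
      simp only [Fin.snocEquiv_apply, Fin.snoc_last, Fin.prod_univ_castSucc, Fin.succ_castSucc,
        Fin.snoc_castSucc, Fin.succ_last]
      rw [Matrix.mulVec, dotProduct, Finset.mul_sum]
      refine Finset.sum_congr rfl fun z _ => ?_
      rw [show (0 : Fin (l + 2)) = Fin.castSucc 0 from rfl, Fin.snoc_castSucc]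
      ring
    rw [Finset.sum_congr rfl fun q _ => h1 q, ih, pow_succ, ← Matrix.vecMul_vecMul,
      Matrix.dotProduct_mulVec]

/-- A sum over the chains of a relation is a combination of powers of any matrix supported on it. -/
theorem finsum_relSeries_eq {α : Type*} [Fintype α] [DecidableEq α] {r : SetRel α α}
    [Finite (RelSeries r)] {N : ℕ} (hN : ∀ Γ : RelSeries r, Γ.length ≤ N) {W : Matrix α α ℂ}
    (hW : ∀ a b, (a, b) ∉ r → W a b = 0) (G : ℕ → ℂ) (h k : α → ℂ) :
    ∑ᶠ Γ : RelSeries r, G Γ.length *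
        (h Γ.head * (∏ i : Fin Γ.length, W (Γ i.castSucc) (Γ i.succ)) * k Γ.last) =
      ∑ l ∈ Finset.range (N + 1), G l * ((h ᵥ* W ^ l) ⬝ᵥ k) := by
  classical
  have := Fintype.ofFinite (RelSeries r)
  rw [finsum_eq_sum_of_fintype, Finset.sum_range]
  simp only [← sum_paths_eq, Finset.mul_sum]
  rw [← Fintype.sum_sigma (fun x : (l : Fin (N + 1)) × (Fin (l.1 + 1) → α) => G x.1 *
    (h (x.2 0) * (∏ i : Fin x.1, W (x.2 i.castSucc) (x.2 i.succ)) * k (x.2 (Fin.last x.1))))]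
  refine Finset.sum_of_injOn (fun Γ => ⟨⟨Γ.length, Nat.lt_succ_of_le (hN Γ)⟩, Γ.toFun⟩) ?_ ?_ ?_ ?_
  · rintro ⟨l, f, hf⟩ - ⟨l', f', hf'⟩ - hF
    simp only [Sigma.mk.injEq, Fin.mk.injEq] at hF
    obtain ⟨rfl, hF⟩ := hF
    obtain rfl := eq_of_heq hF
    rfl
  · simp
  · rintro ⟨⟨l, hl⟩, p⟩ - hp
    have h1 : ∃ i : Fin l, (p i.castSucc, p i.succ) ∉ r := by
      by_contra! hc
      exact hp ⟨⟨l, p, hc⟩, by simp, rfl⟩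
    obtain ⟨i, hi⟩ := h1
    have h2 : ∏ i : Fin l, W (p i.castSucc) (p i.succ) = 0 :=
      Finset.prod_eq_zero (Finset.mem_univ i) (hW _ _ hi)
    simp only [h2, mul_zero, zero_mul]
  · intros; rfl

variable {n : ℕ}

theorem permLE_trans {π ρ σ : Equiv.Perm (Fin n)} (h1 : PermLE π ρ) (h2 : PermLE ρ σ) :
    PermLE π σ := (permLE_trans_iff.1 ⟨h1, h2⟩).1

theorem relSeries_permLE_last {r : SetRel (Equiv.Perm (Fin n)) (Equiv.Perm (Fin n))}
    (hr : ∀ p ∈ r, PermLE p.1 p.2) (Γ : RelSeries r) (i : Fin (Γ.length + 1)) :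
    PermLE (Γ i) Γ.last := by
  induction i using Fin.reverseInduction with
  | last => exact permLE_refl _
  | cast i ih =>
    have h : PermLE (Γ i.castSucc) (Γ i.succ) := hr (Γ i.castSucc, Γ i.succ) (Γ.step i)
    exact permLE_trans h ih

theorem mem_simpleChainsTo {σ : Equiv.Perm (Fin n)} {Γ : RelSeries (simpleRel n)} :
    Γ ∈ simpleChainsTo σ ↔ Γ.last = σ :=
  ⟨fun h => h.2, fun h => ⟨fun i => h ▸ relSeries_permLE_last (fun _ hp => hp.1.1) Γ i, h⟩⟩

theorem mem_fullChains {Γ : RelSeries (strictRel n)} :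
    Γ ∈ fullChains n ↔ Γ.head = 1 ∧ Γ.last = finRotate n :=
  ⟨fun h => h.2, fun h => ⟨fun i => h.2 ▸ relSeries_permLE_last (fun _ hp => hp.1) Γ i, h⟩⟩

theorem simpleRel_length_le (Γ : RelSeries (simpleRel n)) : Γ.length ≤ n :=
  strictRel_length_le (Γ.ofLE (s := strictRel n) fun _ h => h.1)

/-- The first element of a simple chain is free, which is why the powers of the generator are applied
to the constant function `1`. -/
theorem sum_simpleChainsTo (ℓ : ℕ → ℂ) (σ : Equiv.Perm (Fin n)) :
    ∑ᶠ Γ ∈ simpleChainsTo σ, 1 / (Nat.factorial Γ.length : ℂ) *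
        ∏ i : Fin Γ.length, ℓ (permDist (Γ i.succ) (Γ i.castSucc) + 1) =
      ∑ l ∈ Finset.range (n + 1), (1 / l.factorial : ℂ) *
        ((fun _ => 1) ᵥ* cycleMatrix n ℓ ^ l) σ := by
  classical
  have h1 := finsum_relSeries_eq (r := simpleRel n) simpleRel_length_le (W := cycleMatrix n ℓ)
    (fun π σ h => if_neg fun h1 => h ⟨⟨h1.1, fun h2 => ?_⟩, h1.2⟩)
    (fun l => 1 / (l.factorial : ℂ)) (fun _ => 1) (Pi.single σ 1)
  · simp only [dotProduct_single_one] at h1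
    rw [← h1]
    refine finsum_congr fun Γ => ?_
    rw [finsum_eq_if, mem_simpleChainsTo]
    by_cases h2 : Γ.last = σ
    · rw [if_pos h2, h2, Pi.single_eq_same, one_mul, mul_one]
      congr 1
      refine Finset.prod_congr rfl fun i _ => ?_
      have h3 := Γ.step i
      rw [cycleMatrix, if_pos ⟨h3.1.1, h3.2⟩, permDist, ← permLength_inv]
      congr 3
    · rw [if_neg h2, Pi.single_eq_of_ne h2, mul_zero, mul_zero]
  · simp only at h2
    rw [h2, inv_mul_cancel] at h1
    exact Equiv.Perm.not_isCycle_one h1.2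

/-- The sum over the chains from `1` to the full cycle is an entry of the logarithm series of the
matrix of `f`. -/
theorem sum_fullChains {f : Equiv.Perm (Fin n) → ℂ} (hf : f 1 = 1) :
    ∑ᶠ Γ ∈ fullChains n, (-1) ^ (1 + Γ.length) / (Γ.length : ℂ) *
        ∏ i : Fin Γ.length, f ((Γ i.castSucc)⁻¹ * Γ i.succ) =
      ∑ l ∈ Finset.range (n + 1), ((-1) ^ (1 + l) / l : ℂ) *
        ((gradedMatrix f - 1) ^ l) 1 (finRotate n) := by
  classical
  have hW : ∀ π σ : Equiv.Perm (Fin n), (π, σ) ∉ strictRel n → (gradedMatrix f - 1) π σ = 0 := by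
    intro π σ h
    rw [Matrix.sub_apply]
    by_cases h1 : PermLE π σ
    · have h2 : π = σ := by
        by_contra h2
        exact h ⟨h1, h2⟩
      rw [gradedMatrix_of_le _ h1, h2, inv_mul_cancel, hf, Matrix.one_apply_eq, sub_self]
    · rw [gradedMatrix_of_not_le _ h1, Matrix.one_apply_ne, sub_self]
      rintro rfl
      exact h1 (permLE_refl π)
  have h1 := finsum_relSeries_eq (r := strictRel n) strictRel_length_le hW
    (fun l => (-1) ^ (1 + l) / (l : ℂ)) (Pi.single 1 1) (Pi.single (finRotate n) 1)
  simp only [dotProduct_single_one, single_one_vecMul] at h1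
  refine Eq.trans ?_ h1
  refine finsum_congr fun Γ => ?_
  rw [finsum_eq_if, mem_fullChains]
  by_cases h2 : Γ.last = finRotate n
  · by_cases h3 : Γ.head = 1
    · rw [if_pos ⟨h3, h2⟩, h2, h3, Pi.single_eq_same, Pi.single_eq_same, one_mul, mul_one]
      congr 1
      refine Finset.prod_congr rfl fun i _ => ?_
      have h3 := Γ.step i
      rw [Matrix.sub_apply, gradedMatrix_of_le _ h3.1, Matrix.one_apply_ne h3.2, sub_zero]
    · rw [if_neg fun h => h3 h.1, Pi.single_eq_of_ne h3, zero_mul, zero_mul, mul_zero]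
  · rw [if_neg fun h => h2 h.2, Pi.single_eq_of_ne h2, mul_zero, mul_zero]

end Chains

end FreeMul

/-! ### Moments and free log-cumulants from the `S`-transform -/

namespace FreeMul

open Matrix PowerSeries

section Initial

variable {n : ℕ}

theorem cycleProd_mul_pow (a : ℕ → ℂ) (c : ℂ) {f : ℕ → ℂ} (hf : ∀ p, 1 ≤ p → f p = c ^ p * a p)
    (σ : Equiv.Perm (Fin n)) : cycleProd f σ = c ^ n * cycleProd a σ := by
  have h1 : ∀ s : Multiset ℕ, (∀ p ∈ s, 1 ≤ p) →
      (s.map f).prod = c ^ s.sum * (s.map a).prod := by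
    intro s
    induction s using Multiset.induction with
    | empty => simp
    | cons p s ih =>
      intro hs
      rw [Multiset.map_cons, Multiset.prod_cons, Multiset.map_cons, Multiset.prod_cons,
        Multiset.sum_cons, ih fun q hq => hs q (Multiset.mem_cons_of_mem hq),
        hf p (hs p (Multiset.mem_cons_self p s)), pow_add]
      ring
  refine (h1 σ.partition.parts fun p hp => σ.partition.parts_pos hp).trans ?_
  rw [σ.partition.parts_sum]
  exact congrArg (fun k => c ^ k * cycleProd a σ) (Fintype.card_fin n)

theorem cycleProd_eq_one {a : ℕ → ℂ} (σ : Equiv.Perm (Fin n)) (ha : ∀ p, 1 ≤ p → a p = 1) :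
    cycleProd a σ = 1 := by
  refine Multiset.prod_eq_one fun x hx => ?_
  obtain ⟨p, hp, rfl⟩ := Multiset.mem_map.1 hx
  exact ha p (σ.partition.parts_pos hp)

theorem cycleProd_one {a : ℕ → ℂ} (ha : a 1 = 1) : cycleProd a (1 : Equiv.Perm (Fin n)) = 1 := by
  rw [cycleProd, Equiv.Perm.parts_partition]
  simp [ha]

theorem cycleProd_eq_zero {a : ℕ → ℂ} (ha : ∀ p, p ≠ 1 → a p = 0) {σ : Equiv.Perm (Fin n)}
    (hσ : σ ≠ 1) : cycleProd a σ = 0 := by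
  rw [Ne, ← Equiv.Perm.cycleType_eq_zero] at hσ
  obtain ⟨p, hp⟩ := Multiset.exists_mem_of_ne_zero hσ
  refine Multiset.prod_eq_zero (Multiset.mem_map.2 ⟨p, ?_, ha p ?_⟩)
  · rw [Equiv.Perm.parts_partition]
    exact Multiset.mem_add.2 (Or.inl hp)
  · have := Equiv.Perm.two_le_of_mem_cycleType hp
    omega

theorem coeff_one_add_X_pow (p m : ℕ) :
    coeff m ((1 + X : PowerSeries ℂ) ^ p) = (p.choose m : ℂ) := by
  have : ((1 + X : PowerSeries ℂ) ^ p) = (((1 + Polynomial.X) ^ p : Polynomial ℂ) : PowerSeries ℂ) := by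
    simp
  rw [this, Polynomial.coeff_coe, Polynomial.coeff_one_add_X_pow]

variable {Λ : PowerSeries ℂ}

theorem flowCoeff_one_add_X_zero (hΛ : constantCoeff Λ = 0) {p : ℕ} (hp : 1 ≤ p) :
    flowCoeff (1 + X) Λ 0 p = 1 := by
  rw [flowCoeff, expFlow_zero hΛ, mul_one, coeff_one_add_X_pow, Nat.choose_symm_of_eq_add (b := 1)
    (by omega), Nat.choose_one_right, inv_mul_cancel₀]
  exact Nat.cast_ne_zero.2 (by omega)

theorem flowCoeff_one_zero (hΛ : constantCoeff Λ = 0) {p : ℕ} (hp : p ≠ 1) :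
    flowCoeff 1 Λ 0 p = 0 := by
  rw [flowCoeff, expFlow_zero hΛ, mul_one, one_pow, coeff_one]
  split_ifs with h
  · rw [show p = 0 by omega]; simp
  · rw [mul_zero]

theorem flowCoeff_one {φ : PowerSeries ℂ} (hφ : constantCoeff φ = 1) (hΛ : constantCoeff Λ = 0)
    (t : ℂ) : flowCoeff φ Λ t 1 = 1 := by
  simp [flowCoeff, hφ, constantCoeff_expFlow hΛ]

end Initial

section Combinatorial

variable {n : ℕ} (ℓ : ℕ → ℂ)

/-- The moment sequence with `S`-transform `exp (-Λ)` as a sum over simple chains. -/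
theorem cycleProd_moments_eq (σ : Equiv.Perm (Fin n)) :
    cycleProd (flowCoeff (1 + X) (X * mk fun k => ℓ (k + 2)) 1) σ =
      ∑ᶠ Γ ∈ simpleChainsTo σ, 1 / (Nat.factorial Γ.length : ℂ) *
        ∏ i : Fin Γ.length, ℓ (permDist (Γ i.succ) (Γ i.castSucc) + 1) := by
  have h1 := linearFlow_eq (fun t σ => hasDerivAt_cycleProd_flowCoeff (n := n)
    (φ := 1 + X) (by simp) ℓ σ t) 1 σ
  rw [h1, sum_simpleChainsTo]
  have h2 : (cycleProd (flowCoeff (1 + X) (X * mk fun k => ℓ (k + 2)) 0) :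
      Equiv.Perm (Fin n) → ℂ) = fun _ => 1 :=
    funext fun π => cycleProd_eq_one π fun p hp => flowCoeff_one_add_X_zero (by simp) hp
  rw [h2]
  simp

/-- The multiplicative function of the free cumulants is the exponential of the generator. -/
theorem gradedMatrix_cumulants_eq :
    gradedMatrix (cycleProd (flowCoeff 1 (X * mk fun k => ℓ (k + 2)) 1)) =
      ∑ l ∈ Finset.range (n + 1), (1 / l.factorial : ℂ) • cycleMatrix n ℓ ^ l := by
  classical
  have h1 : ∀ σ, cycleProd (flowCoeff 1 (X * mk fun k => ℓ (k + 2)) 1) σ =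
      ∑ l ∈ Finset.range (n + 1), (1 / l.factorial : ℂ) * (cycleMatrix n ℓ ^ l) 1 σ := by
    intro σ
    have h1 := linearFlow_eq (fun t σ => hasDerivAt_cycleProd_flowCoeff (n := n)
      (φ := 1) (by simp) ℓ σ t) 1 σ
    have h2 : (cycleProd (flowCoeff 1 (X * mk fun k => ℓ (k + 2)) 0) :
        Equiv.Perm (Fin n) → ℂ) = Pi.single 1 1 := by
      funext π
      by_cases hπ : π = 1
      · rw [hπ, Pi.single_eq_same, cycleProd_one]
        exact flowCoeff_one (by simp) (by simp) 0
      · rw [Pi.single_eq_of_ne hπ, cycleProd_eq_zero _ hπ]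
        exact fun p hp => flowCoeff_one_zero (by simp) hp
    rw [h1, h2]
    simp
  ext π σ
  have h3 : (∑ l ∈ Finset.range (n + 1), (1 / l.factorial : ℂ) • cycleMatrix n ℓ ^ l) π σ =
      ∑ l ∈ Finset.range (n + 1), (1 / l.factorial : ℂ) * (cycleMatrix n ℓ ^ l) π σ := by
    simp [Matrix.sum_apply]
  have h4 : ∀ l, cycleMatrix n ℓ ^ l = gradedMatrix ((cycleMatrix n ℓ ^ l) 1) := by
    intro l
    conv_lhs => rw [cycleMatrix_eq_gradedMatrix, gradedMatrix_pow, ← cycleMatrix_eq_gradedMatrix]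
  rw [h3]
  by_cases hπσ : PermLE π σ
  · rw [gradedMatrix_of_le _ hπσ, h1]
    refine Finset.sum_congr rfl fun l _ => ?_
    rw [h4 l, gradedMatrix_of_le _ hπσ, gradedMatrix_one_row]
  · rw [gradedMatrix_of_not_le _ hπσ, eq_comm]
    refine Finset.sum_eq_zero fun l _ => ?_
    rw [h4 l, gradedMatrix_of_not_le _ hπσ, mul_zero]

/-- The logarithmic chain sum recovers the generator. -/
theorem sum_fullChains_cumulants (hn : 2 ≤ n) :
    ∑ᶠ Γ ∈ fullChains n, (-1) ^ (1 + Γ.length) / (Γ.length : ℂ) *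
        ∏ i : Fin Γ.length, cycleProd (flowCoeff 1 (X * mk fun k => ℓ (k + 2)) 1)
          ((Γ i.castSucc)⁻¹ * Γ i.succ) = ℓ n := by
  classical
  obtain ⟨m, rfl⟩ : ∃ m, n = m + 2 := ⟨n - 2, by omega⟩
  rw [sum_fullChains (cycleProd_one (flowCoeff_one (by simp) (by simp) 1)),
    gradedMatrix_cumulants_eq]
  have h1 := log_exp_of_pow_eq_zero (cycleMatrix_pow_eq_zero (n := m + 2) ℓ)
  have h2 := congrFun (congrFun h1 1) (finRotate (m + 2))
  rw [Matrix.sum_apply] at h2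
  simp only [Matrix.smul_apply, smul_eq_mul] at h2
  have h3 : (finRotate (m + 2)).IsCycle := isCycle_finRotate
  have h4 : permLength (finRotate (m + 2)) + 1 = m + 2 := by
    rw [isCycle_permLength h3, support_finRotate]
    simp
  refine h2.trans ?_
  rw [cycleMatrix, if_pos ⟨one_permLE _, by simpa using h3⟩, inv_one, one_mul, h4]

end Combinatorial

section STransform

variable {μ : Measure Circle} {S : PowerSeries ℂ}

theorem moment_one_mul_constantCoeff (hS : IsSTransform μ S) :
    moment μ 1 * constantCoeff S = 1 := by
  have h := congrArg (coeff 1) hS.1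
  rw [coeff_subst_eq_sum (by simp) _ (Nat.lt_succ_self 1), Finset.sum_range_succ, Finset.sum_range_one] at h
  have h1 : coeff 1 (X * S * (1 + X)⁻¹) = constantCoeff S := by
    rw [mul_assoc, show (1 : ℕ) = 0 + 1 from rfl, coeff_succ_X_mul]
    simp
  rw [pow_one, h1, coeff_one_X, pow_zero, coeff_one, if_neg one_ne_zero, mul_zero, zero_add,
    map_sub, momentSeries, coeff_mk, coeff_one, if_neg one_ne_zero, sub_zero] at h
  exact h

theorem subst_momentSeries (hS : IsSTransform μ S) :
    (momentSeries μ).subst (X * S * (1 + X)⁻¹) = 1 + X := by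
  have hχ : HasSubst (X * S * (1 + X)⁻¹) := HasSubst.of_constantCoeff_zero' (by simp)
  have h1 := hS.1
  have h3 : (1 : PowerSeries ℂ).subst (X * S * (1 + X)⁻¹) = (1 : PowerSeries ℂ) := by
    rw [← coe_substAlgHom hχ, map_one]
  rw [subst_sub hχ, h3] at h1
  exact sub_eq_iff_eq_add'.1 h1

/-- The `R`-transform is inverse to `z S(z)`. -/
theorem subst_cumulantSeries [IsProbabilityMeasure μ] (hS : IsSTransform μ S) :
    (((momentSeries μ).subst ((X * momentSeries μ).substInvOfIsUnit (isUnit_coeff_one μ))) -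
      1 : PowerSeries ℂ).subst (X * S) = X := by
  set W := (X * momentSeries μ).substInvOfIsUnit (isUnit_coeff_one μ) with hWdef
  have hχ : HasSubst (X * S * (1 + X)⁻¹) := HasSubst.of_constantCoeff_zero' (by simp)
  have hXS : HasSubst (X * S) := HasSubst.of_constantCoeff_zero' (by simp)
  have hW : HasSubst W := HasSubst.substInvOfIsUnit _ _
  have h1 : W.subst (X * momentSeries μ) = X :=
    subst_substInvOfIsUnit_left _ (by simp) _
  have h2 : (X * momentSeries μ).subst (X * S * (1 + X)⁻¹) = X * S := by
    rw [subst_mul hχ, subst_X hχ, subst_momentSeries hS, mul_assoc,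
      PowerSeries.inv_mul_cancel _ (by simp), mul_one]
  have h3 : W.subst (X * S) = X * S * (1 + X)⁻¹ := by
    rw [← h2, ← subst_comp_subst_apply (HasSubst.of_constantCoeff_zero' (by simp)) hχ, h1,
      subst_X hχ, h2]
  have h4 : (1 : PowerSeries ℂ).subst (X * S) = (1 : PowerSeries ℂ) := by
    rw [← coe_substAlgHom hXS, map_one]
  rw [subst_sub hXS, h4, subst_comp_subst_apply hW hXS, h3, subst_momentSeries hS]
  ring

variable {Λ : PowerSeries ℂ}

theorem inv_STransform (hΛ : constantCoeff Λ = 0) {c : ℂ} (hc : c ≠ 0)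
    (h : S = C c⁻¹ * expFlow Λ (-1)) : S⁻¹ = C c * expFlow Λ 1 := by
  rw [PowerSeries.inv_eq_iff_mul_eq_one, h]
  · rw [show C c * expFlow Λ 1 * (C c⁻¹ * expFlow Λ (-1)) =
      (C c * C c⁻¹) * (expFlow Λ 1 * expFlow Λ (-1)) by ring, ← expFlow_add hΛ, ← map_mul,
      mul_inv_cancel₀ hc]
    simp [expFlow_zero hΛ]
  · rw [h, map_mul, constantCoeff_expFlow hΛ]
    simpa using hc

/-- If `A` is inverse to `X S / χ`, its coefficients are those of the flow started at `χ`. -/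
theorem coeff_eq_flowCoeff (hΛ : constantCoeff Λ = 0) {c : ℂ} (hc : c ≠ 0)
    (h : S = C c⁻¹ * expFlow Λ (-1)) {A χ : PowerSeries ℂ} (hχ : constantCoeff χ = 1)
    (hA : A.subst (X * S * χ⁻¹) = X) {p : ℕ} (hp : 1 ≤ p) :
    coeff p A = c ^ p * flowCoeff χ Λ 1 p := by
  have hS : constantCoeff S ≠ 0 := by
    rw [h, map_mul, constantCoeff_expFlow hΛ]
    simpa using hc
  have h1 : (χ * S⁻¹)⁻¹ = S * χ⁻¹ := by
    rw [PowerSeries.mul_inv_rev]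
    congr 1
    rw [PowerSeries.inv_eq_iff_mul_eq_one (by simpa using hS), PowerSeries.mul_inv_cancel _ hS]
  rw [mul_assoc, ← h1] at hA
  have h2 := lagrange_inversion (by simpa [hχ] using hS) hA le_rfl hp
  rw [pow_one, Nat.cast_one, one_mul, inv_STransform hΛ hc h,
    show χ * (C c * expFlow Λ 1) = C c * (χ * expFlow Λ 1) by ring, mul_pow, ← map_pow,
    coeff_C_mul] at h2
  have hp' : (p : ℂ) ≠ 0 := Nat.cast_ne_zero.2 (by omega)
  rw [flowCoeff, mul_left_comm, ← h2, inv_mul_cancel_left₀ hp']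

theorem moment_eq_flowCoeff (hS : IsSTransform μ S) (hΛ : constantCoeff Λ = 0) {c : ℂ}
    (hc : c ≠ 0) (h : S = C c⁻¹ * expFlow Λ (-1)) {p : ℕ} (hp : 1 ≤ p) :
    moment μ p = c ^ p * flowCoeff (1 + X) Λ 1 p := by
  rw [← coeff_eq_flowCoeff hΛ hc h (by simp) hS.1 hp, map_sub, momentSeries, coeff_mk, coeff_one,
    if_neg (by omega), sub_zero]

theorem freeCumulant_eq_flowCoeff [IsProbabilityMeasure μ] (hS : IsSTransform μ S)
    (hΛ : constantCoeff Λ = 0) {c : ℂ}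
    (hc : c ≠ 0) (h : S = C c⁻¹ * expFlow Λ (-1)) {p : ℕ} (hp : 1 ≤ p) :
    freeCumulant μ p = c ^ p * flowCoeff 1 Λ 1 p := by
  have h1 := subst_cumulantSeries hS
  rw [← coeff_eq_flowCoeff hΛ hc h (χ := 1) (by simp) (by simpa using h1) hp, map_sub, coeff_one,
    if_neg (by omega), sub_zero, freeCumulant]

/-- The free log-cumulants are the coefficients of `-log S`. -/
theorem freeLogCumulant_eq [IsProbabilityMeasure μ] (hS : IsSTransform μ S) {ℓ : ℕ → ℂ}
    (h : S = C (moment μ 1)⁻¹ * expFlow (X * mk fun k => ℓ (k + 2)) (-1)) {n : ℕ} (hn : 2 ≤ n) :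
    freeLogCumulant μ n = ℓ n := by
  have hc : moment μ 1 ≠ 0 := left_ne_zero_of_mul_eq_one (moment_one_mul_constantCoeff hS)
  rw [freeLogCumulant, if_neg (by omega), ← sum_fullChains_cumulants ℓ hn]
  refine finsum_congr fun Γ => finsum_congr fun _ => ?_
  congr 1
  refine Finset.prod_congr rfl fun i _ => ?_
  rw [cycleProd_mul_pow _ (moment μ 1) fun p hp =>
    freeCumulant_eq_flowCoeff hS (Λ := X * mk fun k => ℓ (k + 2)) (by simp) hc h hp,
    inv_mul_cancel_left₀ (pow_ne_zero _ hc)]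

/-- The product formula for the moments of a measure whose `S`-transform is `m₁⁻¹ exp (-Λ)`. -/
theorem cycleProd_moment_eq [IsProbabilityMeasure μ] (hS : IsSTransform μ S) {ℓ : ℕ → ℂ}
    (h : S = C (moment μ 1)⁻¹ * expFlow (X * mk fun k => ℓ (k + 2)) (-1)) {n : ℕ}
    (σ : Equiv.Perm (Fin n)) :
    cycleProd (moment μ) σ = Complex.exp (n * freeLogCumulant μ 1) *
      ∑ᶠ Γ ∈ simpleChainsTo σ, 1 / (Nat.factorial Γ.length : ℂ) *
        ∏ i : Fin Γ.length, freeLogCumulant μ (permDist (Γ i.succ) (Γ i.castSucc) + 1) := by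
  have hc : moment μ 1 ≠ 0 := left_ne_zero_of_mul_eq_one (moment_one_mul_constantCoeff hS)
  have h1 : (fun k => ℓ (k + 2)) = fun k => freeLogCumulant μ (k + 2) :=
    funext fun k => (freeLogCumulant_eq hS h (by omega)).symm
  rw [h1] at h
  rw [← cycleProd_moments_eq, cycleProd_mul_pow _ (moment μ 1) fun p hp =>
    moment_eq_flowCoeff hS (by simp) hc h hp, Complex.exp_nat_mul, freeLogCumulant, if_pos rfl,
    Complex.exp_log hc]

end STransform

end FreeMul

/-! ### The `S`-transform of the characteristic pair -/

namespace FreeMul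

open PowerSeries

section FormalODE

theorem derivative_expFlow {Λ : PowerSeries ℂ} (hΛ : constantCoeff Λ = 0) (t : ℂ) :
    d⁄dX ℂ (expFlow Λ t) = C t * (expFlow Λ t * d⁄dX ℂ Λ) := by
  have hs : HasSubst Λ := HasSubst.of_constantCoeff_zero' hΛ
  have h1 : d⁄dX ℂ (rescale t (exp ℂ)) = t • rescale t (exp ℂ) := by
    ext m
    rw [coeff_derivative, coeff_rescale, coeff_smul, coeff_rescale, coeff_exp, coeff_exp,
      Nat.factorial_succ]
    have h3 : (m.factorial : ℂ) ≠ 0 := Nat.cast_ne_zero.2 (Nat.factorial_ne_zero m)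
    have h4 : (m + 1 : ℂ) ≠ 0 := Nat.cast_add_one_ne_zero m
    simp only [eq_ratCast, smul_eq_mul]
    push_cast
    field_simp
    ring
  rw [expFlow, derivative_subst hs, h1, subst_smul hs, smul_eq_C_mul, mul_assoc]

/-- The formal linear differential equation `S' = -Λ' S`. -/
theorem eq_C_mul_expFlow {Λ S : PowerSeries ℂ} (hΛ : constantCoeff Λ = 0)
    (hS : d⁄dX ℂ S = -(d⁄dX ℂ Λ * S)) : S = C (constantCoeff S) * expFlow Λ (-1) := by
  have h1 : S * expFlow Λ 1 = C (constantCoeff S) := by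
    refine derivative.ext ?_ ?_
    · rw [Derivation.leibniz, derivative_expFlow hΛ, hS, derivative_C]
      simp only [smul_eq_mul, map_one]
      ring
    · simp [constantCoeff_expFlow hΛ]
  rw [← h1, mul_assoc, ← expFlow_add hΛ]
  simp [expFlow_zero hΛ]

end FormalODE

section Analytic

/-- A function with a convergent expansion at `0` determines its coefficients. -/
theorem analyticAt_of_eventually_hasSum {f : ℂ → ℂ} {c : ℕ → ℂ}
    (h : ∀ᶠ w in 𝓝 (0 : ℂ), HasSum (fun k => c k * w ^ k) (f w)) :
    AnalyticAt ℂ f 0 ∧ ∀ k, iteratedDeriv k f 0 = k.factorial * c k := by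
  have h1 : HasFPowerSeriesAt f (FormalMultilinearSeries.ofScalars ℂ c) 0 := by
    rw [hasFPowerSeriesAt_iff]
    filter_upwards [h] with w hw
    simpa [FormalMultilinearSeries.coeff_ofScalars, mul_comm] using hw
  refine ⟨h1.analyticAt, fun k => ?_⟩
  have h2 := congrArg (fun p => p.coeff k)
    (h1.eq_formalMultilinearSeries h1.analyticAt.hasFPowerSeriesAt)
  simp only [FormalMultilinearSeries.coeff_ofScalars] at h2
  rw [h2, mul_div_cancel₀]
  exact Nat.cast_ne_zero.2 (Nat.factorial_ne_zero k)

/-- If a convergent power series `S` has sum `c exp J`, with `J` the sum of a power series, then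
`S' = J' S` as formal power series. -/
theorem derivative_eq_of_hasSum_exp {S J : PowerSeries ℂ} {g j : ℂ → ℂ} {c : ℂ}
    (hS : ∀ᶠ w in 𝓝 (0 : ℂ), HasSum (fun k => coeff k S * w ^ k) (g w))
    (hJ : ∀ᶠ w in 𝓝 (0 : ℂ), HasSum (fun k => coeff k J * w ^ k) (j w))
    (hg : ∀ᶠ w in 𝓝 (0 : ℂ), g w = c * Complex.exp (j w)) :
    d⁄dX ℂ S = d⁄dX ℂ J * S := by
  obtain ⟨hga, hgd⟩ := analyticAt_of_eventually_hasSum hS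
  obtain ⟨hja, hjd⟩ := analyticAt_of_eventually_hasSum hJ
  have h1 : deriv g =ᶠ[𝓝 0] deriv j * g := by
    filter_upwards [hg.eventually_nhds, hja.eventually_analyticAt] with w hw hjw
    have h2 : g =ᶠ[𝓝 w] fun w => c * Complex.exp (j w) := hw
    rw [h2.deriv_eq, (hjw.differentiableAt.hasDerivAt.cexp.const_mul c).deriv, Pi.mul_apply,
      hw.self_of_nhds]
    ring
  ext m
  rw [coeff_derivative, coeff_mul, Finset.Nat.sum_antidiagonal_eq_sum_range_succ
    (fun i k => coeff i (d⁄dX ℂ J) * coeff k S)]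
  have h2 : iteratedDeriv (m + 1) g 0 = iteratedDeriv m (deriv j * g) 0 := by
    rw [iteratedDeriv_succ', h1.iteratedDeriv_eq]
  rw [iteratedDeriv_mul hja.deriv.contDiffAt hga.contDiffAt, hgd] at h2
  have h3 : (m.factorial : ℂ) ≠ 0 := Nat.cast_ne_zero.2 (Nat.factorial_ne_zero m)
  apply mul_left_cancel₀ h3
  rw [Nat.factorial_succ] at h2
  push_cast at h2
  rw [show (m.factorial : ℂ) * (coeff (m + 1) S * (m + 1)) =
    (m + 1) * m.factorial * coeff (m + 1) S by ring, h2, Finset.mul_sum]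
  refine Finset.sum_congr rfl fun i hi => ?_
  have hi' : i ≤ m := Nat.lt_succ_iff.1 (Finset.mem_range.1 hi)
  rw [← iteratedDeriv_succ', hjd, hgd, coeff_derivative, Nat.factorial_succ,
    ← Nat.choose_mul_factorial_mul_factorial hi']
  push_cast
  ring

variable {ν : Measure Circle} [IsFiniteMeasure ν]

/-- The expansion of the exponent of the characteristic pair in the variable `w = z / (1 - z)`. -/
noncomputable def exponentSeries (ν : Measure Circle) : PowerSeries ℂ :=
  C (ν.real Set.univ : ℂ) + X * mk fun k => ∫ ζ : Circle, 2 * (ζ : ℂ) * ((ζ : ℂ) - 1) ^ k ∂ν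

theorem integrable_of_continuous {E : Type*} [NormedAddCommGroup E] [SecondCountableTopology E]
    {f : Circle → E} (hf : Continuous f) : Integrable f ν :=
  hf.integrable_of_hasCompactSupport (HasCompactSupport.of_compactSpace f)

theorem norm_sub_one_le (ζ : Circle) : ‖(ζ : ℂ) - 1‖ ≤ 2 := by
  refine (norm_sub_le _ _).trans ?_
  rw [Circle.norm_coe, norm_one]
  norm_num

/-- The expansion in `w` of the exponent at `z = w / (1 + w)`, which is the inverse of
`w = z / (1 - z)`. -/
theorem hasSum_exponentSeries {w : ℂ} (hw : ‖w‖ < 1 / 4) :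
    HasSum (fun k => coeff k (exponentSeries ν) * w ^ k)
      (∫ ζ : Circle, (1 + (ζ : ℂ) * (w / (1 + w))) / (1 - (ζ : ℂ) * (w / (1 + w))) ∂ν) := by
  set F : ℕ → Circle → ℂ := fun k ζ => 2 * (ζ : ℂ) * ((ζ : ℂ) - 1) ^ k * w ^ (k + 1) with hF
  have hFint : ∀ k, Integrable (F k) ν := fun k => integrable_of_continuous (by fun_prop)
  have hFn : ∀ k ζ, ‖F k ζ‖ ≤ (1 / 2) ^ k := by
    intro k ζ
    rw [hF]
    simp only [norm_mul, norm_pow, Circle.norm_coe, Complex.norm_ofNat]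
    calc 2 * 1 * ‖(ζ : ℂ) - 1‖ ^ k * ‖w‖ ^ (k + 1)
        ≤ 2 * 1 * 2 ^ k * (1 / 4) ^ (k + 1) := by
          gcongr
          exact norm_sub_one_le ζ
      _ = (1 / 2) * (1 / 2) ^ k := by
          rw [pow_succ (1 / 4 : ℝ), show (1 / 2 : ℝ) ^ k = (2 * (1 / 4)) ^ k by norm_num, mul_pow]
          ring
      _ ≤ (1 / 2) ^ k := by
          have : (0 : ℝ) ≤ (1 / 2) ^ k := by positivity
          linarith
  have hgeo : Summable fun k : ℕ => (1 / 2 : ℝ) ^ k :=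
    summable_geometric_of_lt_one (by norm_num) (by norm_num)
  have h1 := hasSum_integral_of_summable_integral_norm hFint (by
    refine Summable.of_nonneg_of_le (fun k => integral_nonneg fun ζ => norm_nonneg _)
      (fun k => ?_) (hgeo.mul_right (ν.real Set.univ))
    refine (integral_mono (hFint k).norm (integrable_const _) (hFn k)).trans ?_
    rw [integral_const, smul_eq_mul, mul_comm])
  have hw1 : (1 + w) ≠ 0 := by
    intro h
    have : ‖w‖ = 1 := by rw [eq_neg_of_add_eq_zero_right h]; simp
    rw [this] at hw; norm_num at hw
  have h2 : ∀ ζ : Circle, (1 + (ζ : ℂ) * (w / (1 + w))) / (1 - (ζ : ℂ) * (w / (1 + w))) =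
      1 + ∑' k, F k ζ := by
    intro ζ
    have h3 : ‖((ζ : ℂ) - 1) * w‖ < 1 := by
      rw [norm_mul]
      calc ‖(ζ : ℂ) - 1‖ * ‖w‖ ≤ 2 * (1 / 4) := by
            gcongr
            exact norm_sub_one_le ζ
        _ < 1 := by norm_num
    have h4 : (1 - ((ζ : ℂ) - 1) * w) ≠ 0 := by
      intro h
      rw [← sub_eq_zero.1 h, norm_one] at h3
      exact lt_irrefl _ h3
    have h5 : ∑' k, F k ζ = 2 * ζ * w * (1 - ((ζ : ℂ) - 1) * w)⁻¹ := by
      rw [← tsum_geometric_of_norm_lt_one h3, ← tsum_mul_left]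
      refine tsum_congr fun k => ?_
      simp only [hF, mul_pow]
      ring
    have h6 : (1 - (ζ : ℂ) * (w / (1 + w))) = (1 - ((ζ : ℂ) - 1) * w) / (1 + w) := by
      field_simp
      ring
    rw [h5, h6, div_div_eq_mul_div, div_eq_iff h4]
    linear_combination (ζ : ℂ) * div_mul_cancel₀ w hw1 - 2 * ζ * w * inv_mul_cancel₀ h4
  have h3 : HasSum (fun k => coeff (k + 1) (exponentSeries ν) * w ^ (k + 1))
      (∫ ζ, ∑' k, F k ζ ∂ν) := by
    have h4 : (fun k => coeff (k + 1) (exponentSeries ν) * w ^ (k + 1)) =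
        fun k => ∫ ζ, F k ζ ∂ν := by
      funext k
      rw [exponentSeries, map_add, coeff_succ_X_mul, coeff_mk, coeff_C,
        if_neg (Nat.succ_ne_zero k), zero_add]
      exact (integral_mul_const _ _).symm
    rw [h4]
    exact h1
  have h4 : Integrable (fun ζ => ∑' k, F k ζ) ν := by
    refine integrable_of_continuous (continuous_tsum (fun k => ?_) hgeo hFn)
    rw [hF]
    fun_prop
  rw [integral_congr_ae (Eventually.of_forall h2), integral_add (integrable_const _) h4]
  refine (hasSum_nat_add_iff' 1).1 ?_
  have h5 : (∫ _ : Circle, (1 : ℂ) ∂ν) + ∫ ζ, ∑' k, F k ζ ∂ν -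
      ∑ k ∈ Finset.range 1, coeff k (exponentSeries ν) * w ^ k = ∫ ζ, ∑' k, F k ζ ∂ν := by
    simp [exponentSeries]
  rw [h5]
  exact h3

/-- An `S`-transform that comes from a characteristic pair is a constant times `exp (-Λ)`, with `Λ`
read off from the finite measure `ν`. -/
theorem STransform_eq {S : PowerSeries ℂ} {c : ℂ}
    (h : ∀ᶠ z : ℂ in 𝓝 0, HasSum (fun k : ℕ => coeff k S * (z / (1 - z)) ^ k)
      (c * Complex.exp (∫ ζ : Circle, (1 + (ζ : ℂ) * z) / (1 - (ζ : ℂ) * z) ∂ν))) :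
    constantCoeff S = c * Complex.exp (ν.real Set.univ) ∧
    S = C (constantCoeff S) * expFlow
      (X * mk fun k => -∫ ζ : Circle, 2 * (ζ : ℂ) * ((ζ : ℂ) - 1) ^ k ∂ν) (-1) := by
  have hcont : Tendsto (fun w : ℂ => w / (1 + w)) (𝓝 0) (𝓝 0) := by
    have : ContinuousAt (fun w : ℂ => w / (1 + w)) 0 :=
      continuousAt_id.div (by fun_prop) (by simp)
    simpa [ContinuousAt] using this
  have hsmall : ∀ᶠ w : ℂ in 𝓝 0, ‖w‖ < 1 / 4 := by
    filter_upwards [Metric.ball_mem_nhds (0 : ℂ) (show (0 : ℝ) < 1 / 4 by norm_num)] with w hw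
    exact mem_ball_zero_iff.1 hw
  set j : ℂ → ℂ := fun w =>
    ∫ ζ : Circle, (1 + (ζ : ℂ) * (w / (1 + w))) / (1 - (ζ : ℂ) * (w / (1 + w))) ∂ν with hj
  have hS : ∀ᶠ w : ℂ in 𝓝 0, HasSum (fun k => coeff k S * w ^ k) (c * Complex.exp (j w)) := by
    filter_upwards [hcont.eventually h, hsmall] with w hw hw'
    have hw1 : (1 + w) ≠ 0 := by
      intro h
      have : ‖w‖ = 1 := by rw [eq_neg_of_add_eq_zero_right h]; simp
      rw [this] at hw'; norm_num at hw'
    have : w / (1 + w) / (1 - w / (1 + w)) = w := by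
      field_simp
      ring
    simpa only [this] using hw
  have hJ : ∀ᶠ w : ℂ in 𝓝 0, HasSum (fun k => coeff k (exponentSeries ν) * w ^ k) (j w) := by
    filter_upwards [hsmall] with w hw using hasSum_exponentSeries hw
  have hd := derivative_eq_of_hasSum_exp hS hJ (Eventually.of_forall fun _ => rfl)
  constructor
  · have h1 := hS.self_of_nhds
    have h2 : coeff 0 S = c * Complex.exp (j 0) := by
      refine HasSum.unique (f := fun k => coeff k S * (0 : ℂ) ^ k) ?_ h1
      convert hasSum_single (f := fun k => coeff k S * (0 : ℂ) ^ k) 0 ?_ using 1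
      · simp
      · intro k hk
        simp [hk]
    rw [← coeff_zero_eq_constantCoeff_apply, h2, hj]
    simp
  · refine eq_C_mul_expFlow (by simp) ?_
    rw [hd, exponentSeries, map_add, derivative_C, zero_add, ← neg_mul, ← map_neg]
    congr 3
    ext m
    rcases m with _ | m
    · simp
    · simp [coeff_succ_X_mul]

end Analytic

section Triplet

variable {ν : Measure Circle}

theorem one_sub_re_pos {ζ : Circle} (h : ζ ≠ 1) : 0 < 1 - (ζ : ℂ).re := by
  have h1 := Circle.normSq_coe ζ
  rw [Complex.normSq_apply] at h1
  rcases lt_or_ge (ζ : ℂ).re 1 with h2 | h2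
  · linarith
  · exfalso
    have h3 : (ζ : ℂ).im = 0 := by nlinarith
    have h4 : (ζ : ℂ).re = 1 := by nlinarith
    exact h (Circle.ext (Complex.ext (by simpa using h4) (by simpa using h3)))

/-- The integrals against the Lévy measure, in terms of the measure of the characteristic pair. -/
theorem integral_levy {E : Type*} [NormedAddCommGroup E] [NormedSpace ℝ E] [CompleteSpace E]
    [SecondCountableTopology E] [IsFiniteMeasure ν] {g f : Circle → E} (hf : Continuous f)
    (hfg : ∀ ζ : Circle, ζ ≠ 1 → g ζ = (1 - (ζ : ℂ).re) • f ζ) :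
    Integrable g ((ν.restrict {1}ᶜ).withDensity
        fun ζ => ENNReal.ofReal (1 / (1 - (ζ : ℂ).re))) ∧
      ∫ ζ, g ζ ∂((ν.restrict {1}ᶜ).withDensity
        fun ζ => ENNReal.ofReal (1 / (1 - (ζ : ℂ).re))) = ∫ ζ in {1}ᶜ, f ζ ∂ν := by
  have hm : Measurable fun ζ : Circle => ENNReal.ofReal (1 / (1 - (ζ : ℂ).re)) := by
    have h1 : Measurable fun ζ : Circle => (ζ : ℂ).re :=
      (show Continuous fun ζ : Circle => (ζ : ℂ).re by fun_prop).measurable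
    exact ENNReal.measurable_ofReal.comp ((measurable_const.sub h1).const_div 1)
  have hlt : ∀ᵐ ζ : Circle ∂(ν.restrict {1}ᶜ), ENNReal.ofReal (1 / (1 - (ζ : ℂ).re)) < ⊤ :=
    Eventually.of_forall fun _ => ENNReal.ofReal_lt_top
  have h2 : (fun ζ : Circle => (ENNReal.ofReal (1 / (1 - (ζ : ℂ).re))).toReal • g ζ)
      =ᵐ[ν.restrict {1}ᶜ] f := by
    filter_upwards [ae_restrict_mem (measurableSet_singleton 1).compl] with ζ hζ
    have h3 := one_sub_re_pos (show ζ ≠ 1 from hζ)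
    rw [ENNReal.toReal_ofReal (by positivity), hfg ζ hζ, smul_smul, one_div,
      inv_mul_cancel₀ h3.ne', one_smul]
  rw [integrable_withDensity_iff_integrable_smul' hm hlt,
    integral_withDensity_eq_integral_toReal_smul hm hlt, integral_congr_ae h2,
    integrable_congr h2]
  exact ⟨(integrable_of_continuous hf).integrableOn, rfl⟩

theorem sub_one_sq_eq (ζ : Circle) :
    ((ζ : ℂ) - 1) ^ 2 = (1 - (ζ : ℂ).re : ℝ) • (-(2 * (ζ : ℂ))) := by
  have h1 := Circle.normSq_coe ζ
  rw [Complex.normSq_apply] at h1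
  apply Complex.ext
  · simp [pow_two]
    nlinarith
  · simp [pow_two]
    ring

/-- The coefficients of `Λ` in terms of the triplet. The atom of `ν` at `1` contributes only for
`k = 0`, as `0 ^ 0 = 1`. -/
theorem integral_two_mul_sub_one_pow [IsFiniteMeasure ν] (k : ℕ) :
    Integrable (fun ζ : Circle => ((ζ : ℂ) - 1) ^ (k + 2)) ((ν.restrict {1}ᶜ).withDensity
        fun ζ => ENNReal.ofReal (1 / (1 - (ζ : ℂ).re))) ∧
      -∫ ζ : Circle, 2 * (ζ : ℂ) * ((ζ : ℂ) - 1) ^ k ∂ν =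
        -(2 * (ν.real {1} : ℂ) * 0 ^ k) + ∫ ζ : Circle, ((ζ : ℂ) - 1) ^ (k + 2)
          ∂((ν.restrict {1}ᶜ).withDensity fun ζ => ENNReal.ofReal (1 / (1 - (ζ : ℂ).re))) := by
  have hc : Continuous fun ζ : Circle => 2 * (ζ : ℂ) * ((ζ : ℂ) - 1) ^ k := by fun_prop
  have h1 := integral_levy (ν := ν) (g := fun ζ : Circle => ((ζ : ℂ) - 1) ^ (k + 2))
    (f := fun ζ : Circle => -(2 * (ζ : ℂ) * ((ζ : ℂ) - 1) ^ k)) hc.neg fun ζ _ => by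
      rw [pow_add, sub_one_sq_eq]
      simp only [Complex.real_smul]
      ring
  refine ⟨h1.1, ?_⟩
  rw [h1.2, integral_neg,
    ← integral_add_compl (measurableSet_singleton (1 : Circle)) (integrable_of_continuous hc),
    integral_singleton]
  simp
  ring

end Triplet

end FreeMul

theorem mainTheorem6 (μ : Measure Circle) [IsProbabilityMeasure μ] (hμ : IsFreeMulInfDiv μ)
    (ω : Circle) (b : ℝ) (υ : Measure Circle) (htriplet : IsCharTriplet μ ω b υ) :
    (∀ n : ℕ, 1 ≤ n → ∀ σ : Equiv.Perm (Fin n),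
      cycleProd (moment μ) σ =
        Complex.exp (n * freeLogCumulant μ 1) *
          ∑ᶠ Γ ∈ simpleChainsTo σ, 1 / (Nat.factorial Γ.length : ℂ) *
            ∏ i : Fin Γ.length,
              freeLogCumulant μ (permDist (Γ i.succ) (Γ i.castSucc) + 1)) ∧
    (Integrable (fun ζ : Circle => (ζ : ℂ).re - 1) υ ∧
      freeLogCumulant μ 1 =
        Complex.log (ω : ℂ) - (b : ℂ) / 2 + ((∫ ζ : Circle, ((ζ : ℂ).re - 1) ∂υ : ℝ) : ℂ)) ∧
    (Integrable (fun ζ : Circle => ((ζ : ℂ) - 1) ^ 2) υ ∧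
      freeLogCumulant μ 2 = -(b : ℂ) + ∫ ζ : Circle, ((ζ : ℂ) - 1) ^ 2 ∂υ) ∧
    (∀ n : ℕ, 3 ≤ n →
      Integrable (fun ζ : Circle => ((ζ : ℂ) - 1) ^ n) υ ∧
      freeLogCumulant μ n = ∫ ζ : Circle, ((ζ : ℂ) - 1) ^ n ∂υ) := by
  obtain ⟨ν, ⟨hν, S, hS, hsum⟩, rfl, rfl⟩ := htriplet
  obtain ⟨hS0, hSeq⟩ := STransform_eq hsum
  have hm : moment μ 1 * PowerSeries.constantCoeff S = 1 := moment_one_mul_constantCoeff hS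
  have hm1 : moment μ 1 = (ω : ℂ) * (Real.exp (-ν.real Set.univ) : ℝ) := by
    rw [eq_inv_of_mul_eq_one_left hm, hS0, mul_inv, inv_inv, Complex.ofReal_exp, Complex.ofReal_neg,
      Complex.exp_neg]
  rw [eq_inv_of_mul_eq_one_right hm] at hSeq
  set ℓ : ℕ → ℂ := fun k => -∫ ζ : Circle, 2 * (ζ : ℂ) * ((ζ : ℂ) - 1) ^ (k - 2) ∂ν with hℓ
  have hSℓ : S = PowerSeries.C (moment μ 1)⁻¹ *
      expFlow (PowerSeries.X * PowerSeries.mk fun k => ℓ (k + 2)) (-1) := by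
    simpa only [hℓ, Nat.add_sub_cancel] using hSeq
  have hL : ∀ k, freeLogCumulant μ (k + 2) = _ := fun k => (freeLogCumulant_eq hS hSℓ
    (show 2 ≤ k + 2 by omega)).trans (integral_two_mul_sub_one_pow (ν := ν) k).2
  refine ⟨fun n _ σ => cycleProd_moment_eq hS hSℓ σ, ?_,
    ⟨(integral_two_mul_sub_one_pow 0).1, ?_⟩, ?_⟩
  · have h1 := integral_levy (ν := ν) (g := fun ζ : Circle => (ζ : ℂ).re - 1) (f := fun _ => -1)
      continuous_const fun ζ _ => by simp
    refine ⟨h1.1, ?_⟩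
    rw [h1.2, freeLogCumulant, if_pos rfl, hm1, Complex.log_mul_ofReal _ (Real.exp_pos _) _
      (Circle.coe_ne_zero ω), Real.log_exp, ← measureReal_add_measureReal_compl
      (measurableSet_singleton (1 : Circle))]
    simp
    ring
  · rw [hL 0]
    simp
  · intro n hn
    obtain ⟨k, rfl⟩ : ∃ k, n = k + 1 + 2 := ⟨n - 3, by omega⟩
    refine ⟨(integral_two_mul_sub_one_pow (k + 1)).1, ?_⟩
    rw [hL (k + 1)]
    simp
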